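/- **Setting.** For a multi-index $\alpha\in\mathbb Z_+^n$ put $|\alpha|=\sum_i\alpha_i$ and $\gamma_\alpha=|\alpha|!/(\alpha_1!\cdots\alpha_n!)$; let $e_j$ be the $j$-th unit multi-index, and $\mathbb N_\infty=\mathbb Z_+\cup\{\infty\}$. Dimensions and ranks are taken in $\mathbb N_\infty$ (every infinite dimension is $\infty$). All Hilbert spaces are complex. A commuting row contraction $T=(T_1,\dots,T_n)$ on a Hilbert space $\mathcal H$ is a tuple of bounded operators with $T_iT_j=T_jT_i$ for all $i,j$ whose row operator $T:\mathcal H^n\to\mathcal H$, $(h_1,\dots,h_n)\mapsto\sum_iT_ih_i$, is a contraction; write $T^\alpha=T_1^{\alpha_1}\cdots T_n^{\alpha_n}$, $T^{*\alpha}=T_1^{*\alpha_1}\cdots T_n^{*\alpha_n}$, $D_T=(I-T^*T)^{1/2}$ on $\mathcal H^n$, $D_{T^*}=(I-TT^*)^{1/2}$ on $\mathcal H$, $\mathcal D_T=\overline{\operatorname{ran}}\,D_T$, $\mathcal D_{T^*}=\overline{\operatorname{ran}}\,D_{T^*}$. *Drury–Arveson shift.* For a Hilbert space $\mathcal W$,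 $H^2_n(\mathcal W)$ is the Hilbert space of power series $\sum_\alpha a_\alpha z^\alpha$ with $a_\alpha\in\mathcal W$ and $\sum_\alpha\|a_\alpha\|^2/\gamma_\alpha<\infty$ (this sum being the square of the norm). $T$ is a Drury–Arveson shift if, for some Hilbert space $\mathcal W$, it is unitarily equivalent to $(M_{z_1},\dots,M_{z_n})$ on $H^2_n(\mathcal W)$. Tuples $T$ on $\mathcal H$ and $T'$ on $\mathcal H'$ are unitarily equivalent if there is a unitary $U:\mathcal H\to\mathcal H'$ with $UT_i=T'_iU$ for all $i$. *The invariant.* The characteristic function $\theta_T(z)=\big(-T+D_{T^*}(I-\sum_iz_iT_i^*)^{-1}(z_1I,\dots,z_nI)D_T\big)|_{\mathcal D_T}$ on the unit ball of $\mathbb C^n$ has the Taylor coefficients $\theta_{T,0}=-T|_{\mathcal D_T}$ and $\theta_{T,\alpha}=\sum_{j:\alpha_j\ne0}\gamma_{\alpha-e_j}D_{T^*}T^{*(\alpha-e_j)}P_jD_T|_{\mathcal D_T}$ for $\alpha\neq0$, where $P_j:\mathcal H^n\to\mathcal H$ is the $j$-th coordinate. Let $m=\deg\theta_T\in\mathbb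 N_\infty$ be the supremum of all $|\alpha|$ with $\theta_{T,\alpha}\ne0$ (and $0$ if there is none). For $k\in\mathbb Z_+$ let $\mathcal D_k=\overline{\operatorname{span}}\{T^\alpha D_{T^*}h:h\in\mathcal H,\ |\alpha|\ge k\}$. Let $p=\dim(\mathcal D_m\ominus\mathcal D_{m+1})$ if $m<\infty$ and $p=\dim\mathcal D_{T^*}$ if $m=\infty$. Let $q=\dim\mathcal H_c$, where $\mathcal H_c=\{h\in\mathcal H:\sum_{|\alpha|=k}\gamma_\alpha\|T^{*\alpha}h\|^2=\|h\|^2\text{ for all }k\in\mathbb Z_+\}$. Put $\varphi(T)=(p,m,q)$. *Regularity.* A commuting tuple $T$ on $\mathcal H$ is regular if there is $\epsilon>0$ such that for all $z\in\mathbb C^n$ with $\|z\|<\epsilon$ the subspace $(T-Z)\mathcal H^n=\{\sum_i(T_i-z_iI)h_i\}$ is closed and $\mathcal H$ is the algebraic direct sum of $(T-Z)\mathcal H^n$ and $\mathcal H\ominus\sum_iT_i\mathcal H$. For a commuting row contraction $T$ with $m=\deg\theta_T<\infty$ one also calls $T$ regular if the tuple of restrictions $T_i|_{\mathcal D_m}$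 on the $T$-invariant space $\mathcal D_m$ is regular in this sense. The theorem holds with either meaning of "regular". **Theorem.** Let $T$ on $\mathcal H$ and $T'$ on $\mathcal H'$ be $n$-tuples that are commuting row contractions. (i) $T$ is a Drury–Arveson shift if and only if $T$ is regular and $\varphi(T)\in\mathbb N_\infty\times\{0\}\times\{0\}$. (ii) If $T$ and $T'$ are regular and $\varphi(T)=\varphi(T')=(p,0,0)$ for some $p\in\mathbb N_\infty$, then $\operatorname{rank}D_{T^*}=\operatorname{rank}D_{T'^*}=p$, and $T$ and $T'$ are unitarily equivalent, provided, in case $p=\infty$, that $\mathcal H$ and $\mathcal H'$ are separable. -/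

import Mathlib

open scoped ENNReal InnerProductSpace

noncomputable section

namespace DruryArveson

universe u v

/-! ### Multi-indices -/

/-- The length `|α| = α₁ + ⋯ + αₙ` of a multi-index. -/
def len {n : ℕ} (α : Fin n → ℕ) : ℕ := ∑ i, α i

/-- The multinomial coefficient `γ_α = |α|! / (α₁! ⋯ αₙ!)`. -/
def gam {n : ℕ} (α : Fin n → ℕ) : ℕ := Nat.multinomial Finset.univ α

/-- The `i`-th unit multi-index. -/
def unit {n : ℕ} (i : Fin n) : Fin n → ℕ := Pi.single i 1

theorem gam_pos {n : ℕ} (α : Fin n → ℕ) : 0 < gam α := Nat.multinomial_pos _ _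

theorem gam_le_gam_add_unit {n : ℕ} (α : Fin n → ℕ) (i : Fin n) :
    gam α ≤ gam (α + unit i) := by
  have h1 := Nat.multinomial_spec Finset.univ α
  have h2 := Nat.multinomial_spec Finset.univ (α + unit i)
  have hs : ∑ j, (α + unit i) j = (∑ j, α j) + 1 := by
    simp [unit, Finset.sum_add_distrib]
  have hp : ∏ j, ((α + unit i) j).factorial = (α i + 1) * ∏ j, (α j).factorial := by
    rw [← Finset.mul_prod_erase Finset.univ _ (Finset.mem_univ i),
      ← Finset.mul_prod_erase Finset.univ (fun j => (α j).factorial) (Finset.mem_univ i),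
      ← mul_assoc]
    congr 1
    · simp [unit, Nat.factorial_succ]
    · refine Finset.prod_congr rfl fun j hj => ?_
      simp [unit, Finset.ne_of_mem_erase hj]
  rw [hs, hp, Nat.factorial_succ, ← h1] at h2
  have hP : 0 < ∏ j, (α j).factorial := Finset.prod_pos fun j _ => Nat.factorial_pos _
  have h3 : (α i + 1) * gam (α + unit i) = ((∑ j, α j) + 1) * gam α := by
    apply Nat.eq_of_mul_eq_mul_left hP
    unfold gam
    calc _ = (α i + 1) * (∏ j, (α j).factorial) * Nat.multinomial Finset.univ (α + unit i) := by
            ring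
      _ = _ := by rw [h2]; ring
  have hi : α i ≤ ∑ j, α j := Finset.single_le_sum (fun _ _ => Nat.zero_le _) (Finset.mem_univ i)
  by_contra hlt
  push Not at hlt
  nlinarith [Nat.mul_lt_mul_of_pos_left hlt (Nat.succ_pos (α i)),
    Nat.mul_le_mul_right (gam α) (Nat.succ_le_succ hi)]

/-! ### The vector-valued Drury–Arveson space and its shift -/

/-- The space of possible coefficients of `z^α`: a copy of `W` whose norm is scaled so that
`‖a‖² = ‖a‖²_W / γ_α`. -/
def Coeff {n : ℕ} (W : Type u) (_α : Fin n → ℕ) : Type u := W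

section Coeff

variable {n : ℕ} {W : Type u} [NormedAddCommGroup W] [InnerProductSpace ℂ W]

instance (α : Fin n → ℕ) : AddCommGroup (Coeff W α) := inferInstanceAs (AddCommGroup W)

instance (α : Fin n → ℕ) : Module ℂ (Coeff W α) := inferInstanceAs (Module ℂ W)

/-- The scaled inner product `⟪x, y⟫_W / γ_α`. -/
@[reducible] def coeffCore (α : Fin n → ℕ) : InnerProductSpace.Core ℂ (Coeff W α) where
  inner x y := ((gam α : ℂ))⁻¹ * @inner ℂ W _ x y
  conj_inner_symm x y := by
    rw [map_mul, map_inv₀, map_natCast]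
    congr 1
    exact inner_conj_symm (𝕜 := ℂ) (E := W) x y
  re_inner_nonneg x := by
    have h : ((gam α : ℂ))⁻¹ = (((gam α : ℝ)⁻¹ : ℝ) : ℂ) := by push_cast; rfl
    rw [h]
    erw [RCLike.re_ofReal_mul]
    exact mul_nonneg (inv_nonneg.2 (Nat.cast_nonneg _)) (inner_self_nonneg (𝕜 := ℂ) (E := W))
  add_left x y z := by
    rw [← mul_add]
    congr 1
    exact inner_add_left (𝕜 := ℂ) (E := W) x y z
  smul_left x y r := by
    rw [mul_left_comm]
    congr 1
    exact inner_smul_left (𝕜 := ℂ) (E := W) x y r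
  definite x hx := by
    have hg : ((gam α : ℂ))⁻¹ ≠ 0 := inv_ne_zero (Nat.cast_ne_zero.2 (gam_pos α).ne')
    exact (inner_self_eq_zero (𝕜 := ℂ) (E := W)).1 ((mul_eq_zero.1 hx).resolve_left hg)

instance (α : Fin n → ℕ) : NormedAddCommGroup (Coeff W α) :=
  (coeffCore α).toNormedAddCommGroup

instance (α : Fin n → ℕ) : InnerProductSpace ℂ (Coeff W α) :=
  InnerProductSpace.ofCore (coeffCore α).toCore

theorem Coeff.norm_sq {α : Fin n → ℕ} (x : Coeff W α) :
    ‖x‖ ^ 2 = (gam α : ℝ)⁻¹ * @norm W _ x ^ 2 := by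
  have h := norm_sq_eq_re_inner (𝕜 := ℂ) x
  rw [h]
  change RCLike.re (((gam α : ℂ))⁻¹ * @inner ℂ W _ x x) = _
  have h' : ((gam α : ℂ))⁻¹ = (((gam α : ℝ)⁻¹ : ℝ) : ℂ) := by push_cast; rfl
  rw [h']
  erw [RCLike.re_ofReal_mul]
  congr 1
  exact (norm_sq_eq_re_inner (𝕜 := ℂ) (E := W) x).symm

/-- The `W`-valued Drury–Arveson space `H²ₙ(W)`: all families `(a_α)` in `W`, standing for the
power series `∑ a_α z^α`, with `‖a‖² = ∑ ‖a_α‖² / γ_α < ∞`. -/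
abbrev HSpace (n : ℕ) (W : Type u) [NormedAddCommGroup W] [InnerProductSpace ℂ W] : Type u :=
  lp (fun α : Fin n → ℕ => Coeff W α) 2

/-- The coefficients of `z_i f`: the coefficient of `z^β` is that of `z^(β - e_i)` in `f` if
`β_i ≠ 0`, and `0` if `β_i = 0`. -/
def shiftFun (i : Fin n) (f : ∀ α : Fin n → ℕ, Coeff W α) : ∀ α : Fin n → ℕ, Coeff W α :=
  fun β => if β i = 0 then 0 else (f (β - unit i) : W)

theorem sum_shiftFun_le (i : Fin n) (f : HSpace n W) (s : Finset (Fin n → ℕ)) :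
    ∑ β ∈ s, ‖shiftFun i f β‖ ^ (2 : ℝ≥0∞).toReal ≤ ‖f‖ ^ (2 : ℝ≥0∞).toReal := by
  classical
  have h0 : (2 : ℝ≥0∞).toReal = ((2 : ℕ) : ℝ) := by simp
  have hf := lp.sum_rpow_le_norm_rpow (p := 2) (by simp) f
    ((s.filter fun β => β i ≠ 0).image fun β => β - unit i)
  refine le_trans ?_ hf
  rw [Finset.sum_image]
  · rw [Finset.sum_filter]
    refine Finset.sum_le_sum fun β _ => ?_
    by_cases hβ : β i = 0
    · simp [shiftFun, hβ]
    · simp only [hβ, ne_eq, not_false_eq_true, if_true, h0, Real.rpow_natCast]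
      rw [Coeff.norm_sq, Coeff.norm_sq]
      have hle : gam (β - unit i) ≤ gam β := by
        have := gam_le_gam_add_unit (β - unit i) i
        have he : β - unit i + unit i = β := by
          funext j
          by_cases hj : j = i
          · subst hj; simp [unit]; omega
          · simp [unit, hj]
        rwa [he] at this
      have hpos : (0 : ℝ) < gam (β - unit i) := Nat.cast_pos.2 (gam_pos _)
      have hs : shiftFun i (f : ∀ α, Coeff W α) β = (f (β - unit i) : W) := if_neg hβ
      rw [hs]
      gcongr
  · intro β hβ β' hβ' h
    have h1 : β i ≠ 0 := (Finset.mem_filter.1 hβ).2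
    have h2 : β' i ≠ 0 := (Finset.mem_filter.1 hβ').2
    funext j
    have h3 := congrFun h j
    by_cases hj : j = i
    · subst hj; simp [unit] at h3; omega
    · simpa [unit, hj] using h3

/-- The multiplication operator `M_{z_i}` on `H²ₙ(W)`. -/
def shift (n : ℕ) (W : Type u) [NormedAddCommGroup W] [InnerProductSpace ℂ W] (i : Fin n) :
    HSpace n W →L[ℂ] HSpace n W :=
  LinearMap.mkContinuous
    { toFun := fun f => ⟨shiftFun i f, memℓp_gen' (sum_shiftFun_le i f)⟩
      map_add' := fun f g => by
        ext β
        by_cases hβ : β i = 0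
        · have h (k : HSpace n W) : shiftFun i k β = 0 := if_pos hβ
          change shiftFun i _ β = shiftFun i f β + shiftFun i g β
          rw [h, h, h, add_zero]
        · have h (k : HSpace n W) : shiftFun i k β = (k (β - unit i) : W) := if_neg hβ
          change shiftFun i _ β = shiftFun i f β + shiftFun i g β
          rw [h, h, h]
          rfl
      map_smul' := fun c f => by
        ext β
        by_cases hβ : β i = 0
        · have h (k : HSpace n W) : shiftFun i k β = 0 := if_pos hβ
          change shiftFun i _ β = c • shiftFun i f β
          rw [h, h, smul_zero]
        · have h (k : HSpace n W) : shiftFun i k β = (k (β - unit i) : W) := if_neg hβ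
          change shiftFun i _ β = c • shiftFun i f β
          rw [h, h]
          rfl }
    1 (fun f => by
      rw [one_mul]
      exact lp.norm_le_of_forall_sum_le (p := 2) (by simp) (norm_nonneg _) (sum_shiftFun_le i f))

theorem shift_apply (i : Fin n) (f : HSpace n W) (β : Fin n → ℕ) :
    shift n W i f β = if β i = 0 then 0 else (f (β - unit i) : W) := rfl

instance (α : Fin n → ℕ) [CompleteSpace W] : CompleteSpace (Coeff W α) := by
  have hg : (0 : ℝ) < (gam α : ℝ)⁻¹ := inv_pos.2 (Nat.cast_pos.2 (gam_pos α))
  have hn (x : Coeff W α) : ‖x‖ = √((gam α : ℝ)⁻¹) * @norm W _ x := by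
    rw [← Real.sqrt_sq (norm_nonneg x), Coeff.norm_sq, Real.sqrt_mul hg.le,
      Real.sqrt_sq (norm_nonneg (E := W) x)]
  let e : Coeff W α →ₗ[ℂ] W := { toFun := fun x => x, map_add' := fun _ _ => rfl,
                                  map_smul' := fun _ _ => rfl }
  let e' : W ≃ₗ[ℂ] Coeff W α := { toFun := fun x => x, map_add' := fun _ _ => rfl,
                                   map_smul' := fun _ _ => rfl, invFun := fun x => x,
                                   left_inv := fun _ => rfl, right_inv := fun _ => rfl }
  let E : W ≃L[ℂ] Coeff W α := e'.toContinuousLinearEquivOfBounds (√((gam α : ℝ)⁻¹))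
    ((√((gam α : ℝ)⁻¹))⁻¹) (fun x => (hn (e' x)).le)
    (fun x => by
      rw [hn x, inv_mul_cancel_left₀ (Real.sqrt_pos.2 hg).ne']
      exact le_rfl)
  exact (completeSpace_congr (e := E.toEquiv) E.isUniformEmbedding).1 inferInstance

end Coeff

/-! ### Tuples of operators -/

section Tuple

variable {n : ℕ} {H : Type u} [NormedAddCommGroup H] [InnerProductSpace ℂ H] [CompleteSpace H]

/-- The Hilbert space direct sum `Hⁿ`. -/
abbrev Pow (n : ℕ) (H : Type u) [NormedAddCommGroup H] : Type u :=
  PiLp 2 (fun _ : Fin n => H)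

/-- The coordinate projection `P_j : Hⁿ → H`. -/
def coord (j : Fin n) : Pow n H →L[ℂ] H := PiLp.proj 2 (fun _ : Fin n => H) j

/-- The row operator `(h₁, …, hₙ) ↦ T₁ h₁ + ⋯ + Tₙ hₙ` from `Hⁿ` to `H`. -/
def rowOp (T : Fin n → H →L[ℂ] H) : Pow n H →L[ℂ] H := ∑ i, T i ∘L coord i

/-- Commuting row contractions. -/
structure IsCommutingRowContraction (T : Fin n → H →L[ℂ] H) : Prop where
  comm : ∀ i j, T i ∘L T j = T j ∘L T i
  contraction : ‖rowOp T‖ ≤ 1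

/-- `T^α = T₁^α₁ ⋯ Tₙ^αₙ`. -/
def tuplePow (T : Fin n → H →L[ℂ] H) (α : Fin n → ℕ) : H →L[ℂ] H :=
  (List.ofFn fun i => T i ^ α i).prod

/-- `T^{*α} = T₁^{*α₁} ⋯ Tₙ^{*αₙ}`. -/
def tupleAdjPow (T : Fin n → H →L[ℂ] H) (α : Fin n → ℕ) : H →L[ℂ] H :=
  tuplePow (fun i => ContinuousLinearMap.adjoint (T i)) α

/-- The defect operator `D_T = (I - T* T)^{1/2}` on `Hⁿ`. -/
def defect (T : Fin n → H →L[ℂ] H) : Pow n H →L[ℂ] Pow n H :=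
  CFC.sqrt (1 - ContinuousLinearMap.adjoint (rowOp T) ∘L rowOp T)

/-- The defect operator `D_{T*} = (I - T T*)^{1/2}` on `H`. -/
def defectStar (T : Fin n → H →L[ℂ] H) : H →L[ℂ] H :=
  CFC.sqrt (1 - rowOp T ∘L ContinuousLinearMap.adjoint (rowOp T))

/-- The defect space `𝒟_T`, the closure of the range of `D_T`. -/
def defectSpace (T : Fin n → H →L[ℂ] H) : Submodule ℂ (Pow n H) :=
  (LinearMap.range (defect T).toLinearMap).topologicalClosure

/-- The defect space `𝒟_{T*}`, the closure of the range of `D_{T*}`. -/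
def defectSpaceStar (T : Fin n → H →L[ℂ] H) : Submodule ℂ H :=
  (LinearMap.range (defectStar T).toLinearMap).topologicalClosure

/-- The coefficient `θ_{T,α}` of `z^α` in the Taylor series of the characteristic function
`θ_T(z) = (-T + D_{T*} (I - Z T*)⁻¹ Z D_T)|_{𝒟_T}`, which is `-T|_{𝒟_T}` for `α = 0` and
`∑_j γ_{α-e_j} D_{T*} T^{*(α-e_j)} P_j D_T|_{𝒟_T}` (over the `j` with `α_j ≠ 0`) for `α ≠ 0`.
Its values lie in `𝒟_{T*} ⊆ H`; it is regarded here as an operator into `H`. -/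
def charCoeff (T : Fin n → H →L[ℂ] H) (α : Fin n → ℕ) : defectSpace T →L[ℂ] H :=
  if α = 0 then -(rowOp T ∘L (defectSpace T).subtypeL)
  else ∑ j, if α j = 0 then 0 else
    (gam (α - unit j) : ℂ) •
      (defectStar T ∘L tupleAdjPow T (α - unit j) ∘L coord j ∘L defect T ∘L
        (defectSpace T).subtypeL)

/-- The degree of `θ_T` in `ℕ ∪ {∞}`: the largest `|α|` with `θ_{T,α} ≠ 0`, with the zero
polynomial of degree `0`, and `∞` if `θ_T` is not a polynomial. -/
def charDegree (T : Fin n → H →L[ℂ] H) : ℕ∞ :=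
  ⨆ (α : Fin n → ℕ) (_ : charCoeff T α ≠ 0), (len α : ℕ∞)

/-- `𝒟_m`, the closed linear span of the vectors `T^α D_{T*} h` with `h ∈ H` and `|α| ≥ m`. -/
def tailSpace (T : Fin n → H →L[ℂ] H) (m : ℕ) : Submodule ℂ H :=
  (Submodule.span ℂ
    {x : H | ∃ (α : Fin n → ℕ) (h : H), m ≤ len α ∧
      x = tuplePow T α (defectStar T h)}).topologicalClosure

/-- `H_c`, the span of the set of all `h` with `∑_{|α|=k} γ_α ‖T^{*α} h‖² = ‖h‖²` for every `k`.
(For a commuting row contraction this set already is a closed subspace, the largest one on which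
`T* : H → Hⁿ` is isometric and which is invariant under all `T_i*`.) -/
def coisometricPart (T : Fin n → H →L[ℂ] H) : Submodule ℂ H :=
  Submodule.span ℂ
    {h : H | ∀ k : ℕ, ∑ α ∈ Finset.piAntidiag (Finset.univ : Finset (Fin n)) k,
      (gam α : ℝ) * ‖tupleAdjPow T α h‖ ^ 2 = ‖h‖ ^ 2}

/-- The dimension in `ℕ ∪ {∞}`. -/
def dimENat (V : Submodule ℂ H) : ℕ∞ := Cardinal.toENat (Module.rank ℂ V)

/-- The first component of the invariant: `dim (𝒟_m ⊖ 𝒟_{m+1})` if `m = deg θ_T` is finite and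
`dim 𝒟_{T*}` otherwise. -/
def multiplicity (T : Fin n → H →L[ℂ] H) : ℕ∞ :=
  ENat.recTopCoe (C := fun _ => ℕ∞) (dimENat (defectSpaceStar T))
    (fun m => dimENat (tailSpace T m ⊓ (tailSpace T (m + 1))ᗮ)) (charDegree T)

/-- The invariant `φ(T) = (p, m, q)`. -/
def phi (T : Fin n → H →L[ℂ] H) : ℕ∞ × ℕ∞ × ℕ∞ :=
  (multiplicity T, charDegree T, dimENat (coisometricPart T))

/-- The rank of an operator, in `ℕ ∪ {∞}`. -/
def rankENat (A : H →L[ℂ] H) : ℕ∞ := dimENat (LinearMap.range A.toLinearMap)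

/-- Regularity of a tuple: for all `z` near `0`, the subspace `(T - Z) Hⁿ` is closed and `H` is the
algebraic direct sum of `(T - Z) Hⁿ` and `H ⊖ (T₁ H + ⋯ + Tₙ H)`. -/
def IsRegular (T : Fin n → H →L[ℂ] H) : Prop :=
  ∃ ε : ℝ, 0 < ε ∧ ∀ z : EuclideanSpace ℂ (Fin n), ‖z‖ < ε →
    IsClosed (Set.range (rowOp fun i => T i - z i • (1 : H →L[ℂ] H))) ∧
    IsCompl (LinearMap.range (rowOp fun i => T i - z i • (1 : H →L[ℂ] H)).toLinearMap)
      (⨆ i, LinearMap.range (T i).toLinearMap)ᗮ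

instance (T : Fin n → H →L[ℂ] H) (m : ℕ) : CompleteSpace (tailSpace T m) :=
  inferInstanceAs (CompleteSpace (Submodule.topologicalClosure _))

/-- The upper left block `M_i = P_𝓜 T_i|_𝓜` of `T_i` with respect to `𝓜 = 𝒟_m`; as `𝓜` is
invariant under a commuting tuple `T`, it is the restriction of `T_i` to `𝓜`. -/
def shiftBlock (T : Fin n → H →L[ℂ] H) (m : ℕ) (i : Fin n) :
    tailSpace T m →L[ℂ] tailSpace T m :=
  (tailSpace T m).orthogonalProjectionOnto ∘L T i ∘L (tailSpace T m).subtypeL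

/-- Regularity in the sense of the canonical representation: `θ_T` is a polynomial, of degree `m`
say, and the tuple of the blocks `M_i` on `𝒟_m` is regular. -/
def IsCanonicallyRegular (T : Fin n → H →L[ℂ] H) : Prop :=
  ∃ m : ℕ, charDegree T = m ∧ IsRegular (shiftBlock T m)

/-- Unitary equivalence of tuples. -/
def UnitarilyEquivalent {H' : Type v} [NormedAddCommGroup H'] [InnerProductSpace ℂ H']
    (T : Fin n → H →L[ℂ] H) (T' : Fin n → H' →L[ℂ] H') : Prop :=
  ∃ U : H ≃ₗᵢ[ℂ] H', ∀ i h, U (T i h) = T' i (U h)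

/-- `T` is a Drury–Arveson shift: it is unitarily equivalent to `(M_{z₁}, …, M_{zₙ})` on `H²ₙ(W)`
for some Hilbert space `W`. -/
def IsDruryArvesonShift (T : Fin n → H →L[ℂ] H) : Prop :=
  ∃ (W : Type u) (_ : NormedAddCommGroup W) (_ : InnerProductSpace ℂ W) (_ : CompleteSpace W),
    UnitarilyEquivalent T (shift n W)

end Tuple

end DruryArveson

end

set_option linter.unusedSectionVars false

namespace DruryArveson

/-! ### Multi-indices -/

section MultiIndex

variable {n : ℕ}

/-! Write D for D_{T*}. Everything passes through `IsWold`, a list of algebraic identities that hold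
for the shift, where D is the projection onto the constants and D T^{*α} h is the α-th coefficient
of h divided by γ_α. For a commuting row contraction, `IsWold` is equivalent both to being a
Drury–Arveson shift and to φ(T) = (p, 0, 0) for some p. If deg θ_T = 0, applying θ_{T,α} = 0 (α ≠ 0)
to D_T y and using D_T² = I - T*T gives the linear identity `sum_gam_smul_of_charCoeff_eq_zero`. A
vector y supported in one coordinate yields the rules for D T^{*α} T_i. The choice y = T*h yields D
T^{*α} D² = 0 for α ≠ 0, hence D T^{*α} D = 0. Since H_c = 0 means that the operators D T^{*α}
separate points, T_i^* D = 0 and I - TT* is a projection (`isWold_of_charDegree_eq_zero`). The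
vectors T^α w, w ∈ ran D, then have the Gram matrix of monomials and are total, so they define a
unitary onto H²_n(ran D) that intertwines T with the shift (`IsWold.exists_unitary_shift`).
Conversely, the shift is computed on coefficients (`IsDruryArvesonShift.isWold`). Regularity follows
from `IsWold` because D(I - Σ z_i T_i^*)⁻¹ is a projection onto ran D with kernel (T - Z)H^n. The
first invariant is rank D, which determines ran D up to isometry when it is finite or the spaces are
separable. -/

theorem sub_unit_add_unit {β : Fin n → ℕ} {i : Fin n} (h : β i ≠ 0) : β - unit i + unit i = β := by
  funext j
  by_cases hj : j = i
  · subst hj; simp [unit]; omega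
  · simp [unit, hj]

theorem add_unit_sub_unit (β : Fin n → ℕ) (i : Fin n) : β + unit i - unit i = β := by
  funext j; simp

theorem add_unit_apply_self (β : Fin n → ℕ) (i : Fin n) : (β + unit i) i = β i + 1 := by
  simp [unit]

theorem add_unit_apply_self_ne_zero (β : Fin n → ℕ) (i : Fin n) : (β + unit i) i ≠ 0 := by
  simp [unit]

theorem add_unit_ne_zero (β : Fin n → ℕ) (i : Fin n) : β + unit i ≠ 0 := fun h =>
  add_unit_apply_self_ne_zero β i (by rw [h]; rfl)

theorem len_zero : len (0 : Fin n → ℕ) = 0 := by simp [len]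

theorem len_eq_zero {α : Fin n → ℕ} : len α = 0 ↔ α = 0 := by
  simp [len, funext_iff]

theorem len_add_unit (α : Fin n → ℕ) (i : Fin n) : len (α + unit i) = len α + 1 := by
  simp [len, unit, Finset.sum_add_distrib]

theorem gam_zero : gam (0 : Fin n → ℕ) = 1 := by simp [gam, Nat.multinomial]

theorem gam_add_unit (α : Fin n → ℕ) (i : Fin n) :
    (α i + 1) * gam (α + unit i) = (len α + 1) * gam α := by
  have h1 := Nat.multinomial_spec Finset.univ α
  have h2 := Nat.multinomial_spec Finset.univ (α + unit i)
  have hs : ∑ j, (α + unit i) j = (∑ j, α j) + 1 := len_add_unit α i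
  have hp : ∏ j, ((α + unit i) j).factorial = (α i + 1) * ∏ j, (α j).factorial := by
    rw [← Finset.mul_prod_erase Finset.univ _ (Finset.mem_univ i),
      ← Finset.mul_prod_erase Finset.univ (fun j => (α j).factorial) (Finset.mem_univ i),
      ← mul_assoc]
    congr 1
    · simp [unit, Nat.factorial_succ]
    · refine Finset.prod_congr rfl fun j hj => ?_
      simp [unit, Finset.ne_of_mem_erase hj]
  rw [hs, hp, Nat.factorial_succ, ← h1] at h2
  have hP : 0 < ∏ j, (α j).factorial := Finset.prod_pos fun j _ => Nat.factorial_pos _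
  apply Nat.eq_of_mul_eq_mul_left hP
  unfold gam len
  calc _ = (α i + 1) * (∏ j, (α j).factorial) * Nat.multinomial Finset.univ (α + unit i) := by
          ring
    _ = _ := by rw [h2]; ring

/-- Pascal's rule for multinomial coefficients. -/
theorem gam_eq_sum {α : Fin n → ℕ} (hα : α ≠ 0) :
    gam α = ∑ j, if α j = 0 then 0 else gam (α - unit j) := by
  have hl : 0 < len α := Nat.pos_of_ne_zero fun h => hα (len_eq_zero.1 h)
  -- After multiplication by |α| = Σ α_j the identity holds term by term: α_j γ_α = |α| γ_{α-e_j}.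
  apply Nat.eq_of_mul_eq_mul_left hl
  rw [Finset.mul_sum]
  conv_lhs => rw [len, Finset.sum_mul]
  refine Finset.sum_congr rfl fun j _ => ?_
  by_cases hj : α j = 0
  · simp [hj]
  · have h := gam_add_unit (α - unit j) j
    rw [← len_add_unit _ j, ← add_unit_apply_self, sub_unit_add_unit hj] at h
    rw [if_neg hj, h]

theorem multiIndex_induction {P : (Fin n → ℕ) → Prop} (h0 : P 0)
    (hs : ∀ α i, P α → P (α + unit i)) (α : Fin n → ℕ) : P α := by
  induction hk : len α generalizing α with
  | zero => rw [len_eq_zero.1 hk]; exact h0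
  | succ k ih =>
    have : ∃ i, α i ≠ 0 := by
      by_contra! hc
      have : α = 0 := funext hc
      rw [this, len_zero] at hk
      omega
    obtain ⟨i, hi⟩ := this
    rw [← sub_unit_add_unit hi] at hk ⊢
    rw [len_add_unit] at hk
    exact hs _ _ (ih _ (by omega))

/-- Pairs (β, j) with |β| = k+1 and β_j ≠ 0 correspond to pairs (α, j) with |α| = k through β = α +
e_j. Combined with `gam_eq_sum`, this gives the recursions in the degree. -/
theorem sum_piAntidiag_succ {M : Type*} [AddCommMonoid M] (k : ℕ)
    (g : (Fin n → ℕ) → Fin n → M) :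
    ∑ β ∈ Finset.piAntidiag (Finset.univ : Finset (Fin n)) (k + 1),
        ∑ j, (if β j = 0 then 0 else g (β - unit j) j) =
      ∑ α ∈ Finset.piAntidiag (Finset.univ : Finset (Fin n)) k, ∑ j, g α j := by
  rw [Finset.sum_comm]
  conv_rhs => rw [Finset.sum_comm]
  refine Finset.sum_congr rfl fun j _ => ?_
  have hif : ∀ β : Fin n → ℕ, (if β j = 0 then 0 else g (β - unit j) j) =
      if β j ≠ 0 then g (β - unit j) j else 0 := fun β => by simp
  simp_rw [hif]
  rw [← Finset.sum_filter]
  symm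
  refine Finset.sum_bij' (fun α _ => α + unit j) (fun β _ => β - unit j) ?_ ?_ ?_ ?_ ?_
  · intro α hα
    rw [Finset.mem_piAntidiag] at hα
    rw [Finset.mem_filter, Finset.mem_piAntidiag]
    refine ⟨⟨?_, fun _ _ => Finset.mem_univ _⟩, add_unit_apply_self_ne_zero _ _⟩
    rw [← hα.1]
    exact len_add_unit α j
  · intro β hβ
    rw [Finset.mem_filter, Finset.mem_piAntidiag] at hβ
    rw [Finset.mem_piAntidiag]
    refine ⟨?_, fun _ _ => Finset.mem_univ _⟩
    have h := len_add_unit (β - unit j) j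
    rw [sub_unit_add_unit hβ.2] at h
    have h' : len β = k + 1 := hβ.1.1
    change len (β - unit j) = k
    omega
  · intro α _; exact add_unit_sub_unit _ _
  · intro β hβ; exact sub_unit_add_unit (Finset.mem_filter.1 hβ).2
  · intro α _; simp only [add_unit_sub_unit]

theorem piAntidiag_univ_zero :
    Finset.piAntidiag (Finset.univ : Finset (Fin n)) 0 = {0} := by
  simp

theorem prod_ofFn_pow_add_unit {M : Type*} [Monoid M] (f : Fin n → M)
    (hf : ∀ i j, f i * f j = f j * f i) (α : Fin n → ℕ) (i : Fin n) :
    (List.ofFn fun j => f j ^ (α + unit i) j).prod =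
      f i * (List.ofFn fun j => f j ^ α j).prod := by
  induction n with
  | zero => exact i.elim0
  | succ n ih =>
    rw [List.ofFn_succ, List.ofFn_succ, List.prod_cons, List.prod_cons]
    refine Fin.cases ?_ (fun k => ?_) i
    · rw [add_unit_apply_self, pow_succ', mul_assoc]
      congr 3
    · have h0 : (α + unit k.succ) 0 = α 0 := by simp [unit]
      have hs : ∀ j : Fin n, (α + unit k.succ) j.succ = ((fun l => α (Fin.succ l)) + unit k) j := by
        intro j
        simp [unit, Pi.single_apply]
      simp_rw [hs]
      rw [ih (fun j => f j.succ) (fun a b => hf _ _), h0, ← mul_assoc, ← mul_assoc]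
      congr 1
      exact (Commute.pow_left (hf 0 k.succ) (α 0)).eq

theorem prod_ofFn_pow_zero {M : Type*} [Monoid M] (f : Fin n → M) :
    (List.ofFn fun j => f j ^ (0 : Fin n → ℕ) j).prod = 1 := by
  apply List.prod_eq_one
  intro x hx
  obtain ⟨j, rfl⟩ := (List.mem_ofFn' _ _).1 hx
  simp

end MultiIndex

/-! ### Powers of commuting tuples -/

section Tuple

variable {n : ℕ} {H : Type*} [NormedAddCommGroup H] [InnerProductSpace ℂ H] [CompleteSpace H]

open ContinuousLinearMap

theorem tuplePow_zero (T : Fin n → H →L[ℂ] H) : tuplePow T 0 = 1 := prod_ofFn_pow_zero T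

theorem tuplePow_add_unit {T : Fin n → H →L[ℂ] H} (hc : ∀ i j, T i ∘L T j = T j ∘L T i)
    (α : Fin n → ℕ) (i : Fin n) : tuplePow T (α + unit i) = T i * tuplePow T α :=
  prod_ofFn_pow_add_unit T hc α i

theorem comp_tuplePow {T : Fin n → H →L[ℂ] H} (hc : ∀ i j, T i ∘L T j = T j ∘L T i)
    (α : Fin n → ℕ) (i : Fin n) : T i * tuplePow T α = tuplePow T α * T i := by
  induction α using multiIndex_induction with
  | h0 => simp [tuplePow_zero]
  | hs α j ih =>
    rw [tuplePow_add_unit hc, ← mul_assoc, show T i * T j = T j * T i from hc i j, mul_assoc, ih,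
      mul_assoc]

theorem adjoint_comm {T : Fin n → H →L[ℂ] H} (hc : ∀ i j, T i ∘L T j = T j ∘L T i) (i j : Fin n) :
    adjoint (T i) ∘L adjoint (T j) = adjoint (T j) ∘L adjoint (T i) := by
  rw [← adjoint_comp, ← adjoint_comp, hc]

theorem tupleAdjPow_zero (T : Fin n → H →L[ℂ] H) : tupleAdjPow T 0 = 1 := tuplePow_zero _

theorem tupleAdjPow_add_unit {T : Fin n → H →L[ℂ] H} (hc : ∀ i j, T i ∘L T j = T j ∘L T i)
    (α : Fin n → ℕ) (i : Fin n) :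
    tupleAdjPow T (α + unit i) = adjoint (T i) * tupleAdjPow T α :=
  tuplePow_add_unit (adjoint_comm hc) α i

theorem tupleAdjPow_add_unit' {T : Fin n → H →L[ℂ] H} (hc : ∀ i j, T i ∘L T j = T j ∘L T i)
    (α : Fin n → ℕ) (i : Fin n) :
    tupleAdjPow T (α + unit i) = tupleAdjPow T α * adjoint (T i) := by
  rw [tupleAdjPow_add_unit hc]
  exact comp_tuplePow (adjoint_comm hc) α i

theorem adjoint_tuplePow {T : Fin n → H →L[ℂ] H} (hc : ∀ i j, T i ∘L T j = T j ∘L T i)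
    (α : Fin n → ℕ) : adjoint (tuplePow T α) = tupleAdjPow T α := by
  induction α using multiIndex_induction with
  | h0 => rw [tuplePow_zero, tupleAdjPow_zero]; exact adjoint_id
  | hs α j ih =>
    rw [tuplePow_add_unit hc, tupleAdjPow_add_unit' hc, ← ih]
    exact adjoint_comp _ _

/-! ### The row operator and the defect operators -/

theorem rowOp_apply (T : Fin n → H →L[ℂ] H) (x : Pow n H) : rowOp T x = ∑ i, T i (x i) := by
  simp [rowOp, coord]

theorem adjoint_rowOp_apply (T : Fin n → H →L[ℂ] H) (h : H) (i : Fin n) :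
    adjoint (rowOp T) h i = adjoint (T i) h := by
  classical
  refine ext_inner_right ℂ fun v => ?_
  have h1 : ⟪adjoint (rowOp T) h, (PiLp.single 2 i v : Pow n H)⟫_ℂ =
      ⟪adjoint (rowOp T) h i, v⟫_ℂ := by
    rw [PiLp.inner_apply, Finset.sum_eq_single i]
    · simp
    · intro j _ hj; simp [hj]
    · simp
  rw [← h1, adjoint_inner_left, adjoint_inner_left, rowOp_apply, Finset.sum_eq_single i]
  · simp
  · intro j _ hj; simp [hj]
  · simp

theorem rowOp_adjoint_apply (T : Fin n → H →L[ℂ] H) (h : H) :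
    rowOp T (adjoint (rowOp T) h) = ∑ i, T i (adjoint (T i) h) := by
  rw [rowOp_apply]
  simp_rw [adjoint_rowOp_apply]

/-- `CFC.sqrt` squares back to its argument only on nonnegative elements; this positivity makes the
defect operators genuine square roots. -/
theorem one_sub_nonneg_of_norm_le_one {E : Type*} [NormedAddCommGroup E] [InnerProductSpace ℂ E]
    [CompleteSpace E] {F : Type*} [NormedAddCommGroup F] [InnerProductSpace ℂ F]
    [CompleteSpace F] (A : E →L[ℂ] F) (hA : ‖A‖ ≤ 1) : 0 ≤ 1 - adjoint A ∘L A := by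
  rw [ContinuousLinearMap.nonneg_iff_isPositive, ContinuousLinearMap.isPositive_iff']
  constructor
  · rw [isSelfAdjoint_iff']
    rw [map_sub, adjoint_comp, adjoint_adjoint]
    congr 1
    exact adjoint_id
  · intro x
    have h : ⟪(1 - adjoint A ∘L A) x, x⟫_ℂ = ((‖x‖ ^ 2 - ‖A x‖ ^ 2 : ℝ) : ℂ) := by
      change ⟪x - adjoint A (A x), x⟫_ℂ = _
      rw [inner_sub_left, adjoint_inner_left, inner_self_eq_norm_sq_to_K, inner_self_eq_norm_sq_to_K]
      push_cast; rfl
    rw [h]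
    have h2 : ‖A x‖ ≤ ‖x‖ := by simpa using A.le_of_opNorm_le hA x
    rw [Complex.zero_le_real]
    nlinarith [norm_nonneg (A x)]

theorem defect_mul_self {T : Fin n → H →L[ℂ] H} (hT : ‖rowOp T‖ ≤ 1) :
    defect T * defect T = 1 - adjoint (rowOp T) ∘L rowOp T :=
  CFC.sqrt_mul_sqrt_self _ (one_sub_nonneg_of_norm_le_one _ hT)

theorem defectStar_mul_self {T : Fin n → H →L[ℂ] H} (hT : ‖rowOp T‖ ≤ 1) :
    defectStar T * defectStar T = 1 - rowOp T ∘L adjoint (rowOp T) := by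
  refine CFC.sqrt_mul_sqrt_self _ ?_
  have h := one_sub_nonneg_of_norm_le_one (adjoint (rowOp T))
    (by rw [LinearIsometryEquiv.norm_map]; exact hT)
  rwa [adjoint_adjoint] at h

theorem isSelfAdjoint_defectStar (T : Fin n → H →L[ℂ] H) : IsSelfAdjoint (defectStar T) :=
  (CFC.sqrt_nonneg _).isSelfAdjoint

theorem adjoint_defectStar (T : Fin n → H →L[ℂ] H) : adjoint (defectStar T) = defectStar T :=
  (isSelfAdjoint_defectStar T).adjoint_eq

theorem inner_defectStar (T : Fin n → H →L[ℂ] H) (x y : H) :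
    ⟪defectStar T x, y⟫_ℂ = ⟪x, defectStar T y⟫_ℂ := by
  conv_lhs => rw [← adjoint_defectStar T]
  exact adjoint_inner_left _ _ _

/-- A self-adjoint idempotent is X*X ≥ 0 and is its own square root. No norm bound enters, so this
also serves `IsWold`, which contains none. -/
theorem defectStar_eq_of_idempotent {T : Fin n → H →L[ℂ] H}
    (h : IsIdempotentElem (1 - rowOp T ∘L adjoint (rowOp T))) :
    defectStar T = 1 - rowOp T ∘L adjoint (rowOp T) := by
  set X := 1 - rowOp T ∘L adjoint (rowOp T) with hX
  have hsa : IsSelfAdjoint X := by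
    rw [isSelfAdjoint_iff', hX, map_sub, adjoint_comp, adjoint_adjoint]
    congr 1
    exact adjoint_id
  have h0 : 0 ≤ X := by
    have := star_mul_self_nonneg X
    rwa [hsa.star_eq, h.eq] at this
  have := CFC.sqrt_mul_self X h0
  rwa [h.eq] at this

end Tuple

end DruryArveson

namespace DruryArveson

/-! ### From the invariant to the Gram matrix: Wold-type tuples -/

section Wold

variable {n : ℕ} {H : Type*} [NormedAddCommGroup H] [InnerProductSpace ℂ H] [CompleteSpace H]

open ContinuousLinearMap

/-- Commuting tuples for which the row operator is a partial isometry, `D_{T*}` intertwines the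
adjoint powers with `T_i` as evaluation of coefficients does for the Drury–Arveson shift, and the
family `D_{T*} T^{*α}` separates points. -/
structure IsWold (T : Fin n → H →L[ℂ] H) : Prop where
  comm : ∀ i j, T i ∘L T j = T j ∘L T i
  idem : IsIdempotentElem (1 - rowOp T ∘L adjoint (rowOp T))
  gam_smul : ∀ α i h, (gam (α + unit i) : ℂ) • defectStar T (tupleAdjPow T (α + unit i) (T i h)) =
    (gam α : ℂ) • defectStar T (tupleAdjPow T α h)
  eq_zero : ∀ α i h, α i = 0 → defectStar T (tupleAdjPow T α (T i h)) = 0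
  separating : ∀ h, (∀ α, defectStar T (tupleAdjPow T α h) = 0) → h = 0

/-! ### Vanishing Taylor coefficients of the characteristic function -/

theorem charCoeff_eq_zero_of_charDegree {T : Fin n → H →L[ℂ] H} (h : charDegree T = 0)
    {α : Fin n → ℕ} (hα : α ≠ 0) : charCoeff T α = 0 := by
  by_contra hc
  have h1 : (len α : ℕ∞) ≤ charDegree T := le_iSup₂_of_le α hc le_rfl
  rw [h] at h1
  have h2 : len α = 0 := by simpa using h1
  exact hα (len_eq_zero.1 h2)

theorem charDegree_eq_zero {T : Fin n → H →L[ℂ] H} (h : ∀ α, α ≠ 0 → charCoeff T α = 0) :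
    charDegree T = 0 := by
  refine le_antisymm (iSup₂_le fun α hα => ?_) zero_le
  have : α = 0 := by
    by_contra h0
    exact hα (h α h0)
  rw [this, len_zero]
  rfl

theorem charCoeff_apply {T : Fin n → H →L[ℂ] H} {α : Fin n → ℕ} (hα : α ≠ 0) (x : defectSpace T) :
    charCoeff T α x = ∑ j, if α j = 0 then 0 else (gam (α - unit j) : ℂ) •
      defectStar T (tupleAdjPow T (α - unit j) (defect T (x : Pow n H) j)) := by
  rw [charCoeff, if_neg hα, _root_.sum_apply]
  refine Finset.sum_congr rfl fun j _ => ?_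
  split_ifs <;> rfl

/-- Evaluate θ_{T,α} at D_T y. By D_T² = I - T*T the j-th coordinate becomes y_j - T_j^* T y, and
Pascal's rule collects the second parts into γ_α D T^{*α} T y. -/
theorem sum_gam_smul_of_charCoeff_eq_zero {T : Fin n → H →L[ℂ] H}
    (hT : IsCommutingRowContraction T) {α : Fin n → ℕ} (hα : α ≠ 0) (h : charCoeff T α = 0)
    (y : Pow n H) :
    (∑ j, if α j = 0 then 0 else (gam (α - unit j) : ℂ) •
      defectStar T (tupleAdjPow T (α - unit j) (y j))) =
      (gam α : ℂ) • defectStar T (tupleAdjPow T α (rowOp T y)) := by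
  have hmem : defect T y ∈ defectSpace T :=
    Submodule.le_topologicalClosure _ ⟨y, rfl⟩
  have h1 := charCoeff_apply hα ⟨defect T y, hmem⟩
  have h2 : ∀ j, defect T (defect T y) j = y j - adjoint (T j) (rowOp T y) := by
    intro j
    rw [← adjoint_rowOp_apply]
    exact congrArg (fun A : Pow n H →L[ℂ] Pow n H => A y j) (defect_mul_self hT.contraction)
  rw [h] at h1
  simp only [h2] at h1
  have h3 : ∀ j, (if α j = 0 then (0 : H) else (gam (α - unit j) : ℂ) •
      defectStar T (tupleAdjPow T (α - unit j) (y j - adjoint (T j) (rowOp T y)))) =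
      (if α j = 0 then 0 else (gam (α - unit j) : ℂ) •
        defectStar T (tupleAdjPow T (α - unit j) (y j))) -
      ((if α j = 0 then 0 else gam (α - unit j) : ℕ) : ℂ) •
        defectStar T (tupleAdjPow T α (rowOp T y)) := by
    intro j
    by_cases hj : α j = 0
    · simp [hj]
    · rw [if_neg hj, if_neg hj, if_neg hj, map_sub, map_sub, smul_sub]
      conv_rhs => rw [← sub_unit_add_unit hj, tupleAdjPow_add_unit' hT.comm, sub_unit_add_unit hj]
      rfl
  rw [Finset.sum_congr rfl fun j _ => h3 j, Finset.sum_sub_distrib, ← Finset.sum_smul,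
    ← Nat.cast_sum, ← gam_eq_sum hα] at h1
  exact sub_eq_zero.1 h1.symm

/-! ### The coisometric part -/

theorem norm_sq_defectStar_apply {T : Fin n → H →L[ℂ] H} (hT : ‖rowOp T‖ ≤ 1) (h : H) :
    ‖defectStar T h‖ ^ 2 = ‖h‖ ^ 2 - ∑ i, ‖adjoint (T i) h‖ ^ 2 := by
  have h1 : ⟪defectStar T h, defectStar T h⟫_ℂ =
      ⟪h, h⟫_ℂ - ∑ i, ⟪adjoint (T i) h, adjoint (T i) h⟫_ℂ := by
    rw [inner_defectStar]
    have : defectStar T (defectStar T h) = h - ∑ i, T i (adjoint (T i) h) := by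
      rw [← rowOp_adjoint_apply]
      exact congrArg (fun A : H →L[ℂ] H => A h) (defectStar_mul_self hT)
    rw [this, inner_sub_right, inner_sum]
    simp_rw [adjoint_inner_left]
  simp_rw [inner_self_eq_norm_sq_to_K] at h1
  exact_mod_cast h1

/-- By ‖Dg‖² = ‖g‖² - Σ ‖T_i^* g‖², the loss between consecutive degrees consists exactly of defect
terms. Hence H_c = 0 if and only if the operators D T^{*α} separate points; the next two lemmas are
the two directions. -/
theorem sum_gam_mul_norm_sq_succ {T : Fin n → H →L[ℂ] H} (hT : IsCommutingRowContraction T)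
    (h : H) (k : ℕ) :
    ∑ α ∈ Finset.piAntidiag (Finset.univ : Finset (Fin n)) (k + 1),
      (gam α : ℝ) * ‖tupleAdjPow T α h‖ ^ 2 =
    ∑ α ∈ Finset.piAntidiag (Finset.univ : Finset (Fin n)) k,
      (gam α : ℝ) * ‖tupleAdjPow T α h‖ ^ 2 -
    ∑ α ∈ Finset.piAntidiag (Finset.univ : Finset (Fin n)) k,
      (gam α : ℝ) * ‖defectStar T (tupleAdjPow T α h)‖ ^ 2 := by
  simp_rw [norm_sq_defectStar_apply hT.contraction, mul_sub, Finset.sum_sub_distrib, sub_sub_cancel,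
    Finset.mul_sum]
  rw [← sum_piAntidiag_succ k fun α i => (gam α : ℝ) * ‖adjoint (T i) (tupleAdjPow T α h)‖ ^ 2]
  refine Finset.sum_congr rfl fun β hβ => ?_
  have hβ0 : β ≠ 0 := by
    rintro rfl
    have h1 : len (0 : Fin n → ℕ) = k + 1 := (Finset.mem_piAntidiag.1 hβ).1
    rw [len_zero] at h1
    omega
  rw [gam_eq_sum hβ0, Nat.cast_sum, Finset.sum_mul]
  refine Finset.sum_congr rfl fun j _ => ?_
  by_cases hj : β j = 0
  · simp [hj]
  · rw [if_neg hj, if_neg hj]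
    conv_lhs => rw [← sub_unit_add_unit hj, tupleAdjPow_add_unit hT.comm, sub_unit_add_unit hj]
    rfl

theorem mem_coisometricPart_of_forall_eq_zero {T : Fin n → H →L[ℂ] H}
    (hT : IsCommutingRowContraction T) {h : H}
    (hh : ∀ α, defectStar T (tupleAdjPow T α h) = 0) : h ∈ coisometricPart T := by
  refine Submodule.subset_span fun k => ?_
  induction k with
  | zero => simp [gam_zero, tupleAdjPow_zero]
  | succ k ih => rw [sum_gam_mul_norm_sq_succ hT, ih]; simp [hh]

theorem coisometricPart_eq_bot {T : Fin n → H →L[ℂ] H} (hT : IsCommutingRowContraction T)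
    (hsep : ∀ h, (∀ α, defectStar T (tupleAdjPow T α h) = 0) → h = 0) : coisometricPart T = ⊥ := by
  rw [coisometricPart, Submodule.span_eq_bot]
  refine fun h hh => hsep h fun α => ?_
  have h1 := sum_gam_mul_norm_sq_succ hT h (len α)
  -- Equal sums in degrees |α| and |α|+1 make a sum of nonnegative defect terms vanish, hence each
  -- of them.
  rw [hh, hh, eq_comm, sub_eq_self, Finset.sum_eq_zero_iff_of_nonneg fun β _ => by positivity] at h1
  have h2 := h1 α (Finset.mem_piAntidiag.2 ⟨rfl, fun _ _ => Finset.mem_univ _⟩)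
  have h3 : (gam α : ℝ) ≠ 0 := Nat.cast_ne_zero.2 (gam_pos α).ne'
  simpa [h3] using h2

theorem dimENat_eq_zero {V : Submodule ℂ H} : dimENat V = 0 ↔ V = ⊥ := by
  rw [dimENat, Cardinal.toENat_eq_zero, Submodule.rank_eq_zero]

/-! ### Constant characteristic functions

For a constant characteristic function and trivial coisometric part, the Gram matrix of the vectors
`T^α D_{T*} h` is already that of the Drury–Arveson space, so that regularity is automatic. -/

theorem isWold_of_charDegree_eq_zero {T : Fin n → H →L[ℂ] H} (hT : IsCommutingRowContraction T)
    (hdeg : charDegree T = 0) (hco : coisometricPart T = ⊥) : IsWold T := by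
  classical
  have hc := hT.comm
  have hsep : ∀ h, (∀ α, defectStar T (tupleAdjPow T α h) = 0) → h = 0 := fun h hh => by
    simpa [hco] using mem_coisometricPart_of_forall_eq_zero hT hh
  have hg : ∀ α : Fin n → ℕ, (gam α : ℂ) ≠ 0 := fun α => Nat.cast_ne_zero.2 (gam_pos α).ne'
  have key : ∀ {α : Fin n → ℕ}, α ≠ 0 → ∀ y : Pow n H, _ := fun {α} hα y =>
    sum_gam_smul_of_charCoeff_eq_zero hT hα (charCoeff_eq_zero_of_charDegree hdeg hα) y
  have key1 : ∀ {α : Fin n → ℕ}, α ≠ 0 → ∀ i h,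
      (if α i = 0 then 0 else (gam (α - unit i) : ℂ) •
        defectStar T (tupleAdjPow T (α - unit i) h)) =
      (gam α : ℂ) • defectStar T (tupleAdjPow T α (T i h)) := by
    intro α hα i h
    -- A vector supported in the i-th coordinate isolates T_i.
    have h1 := key hα (PiLp.single 2 i h)
    rw [rowOp_apply, Finset.sum_eq_single i, Finset.sum_eq_single i] at h1
    · simpa using h1
    · intro j _ hj; simp [hj]
    · simp
    · intro j _ hj; simp [hj]
    · simp
  have hDD : ∀ h, defectStar T (defectStar T h) = h - ∑ i, T i (adjoint (T i) h) := fun h => by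
    rw [← rowOp_adjoint_apply]
    exact congrArg (fun A : H →L[ℂ] H => A h) (defectStar_mul_self hT.contraction)
  have key2 : ∀ {α : Fin n → ℕ}, α ≠ 0 → ∀ h,
      defectStar T (tupleAdjPow T α (defectStar T (defectStar T h))) = 0 := by
    intro α hα h
    -- For y = T*h, Pascal's rule turns the left side into γ_α D T^{*α} h, while Ty = TT*h = h -
    -- D²h.
    have h1 := key hα (adjoint (rowOp T) h)
    rw [rowOp_adjoint_apply] at h1
    have h2 : (gam α : ℂ) • defectStar T (tupleAdjPow T α h) =
        ∑ j, if α j = 0 then 0 else (gam (α - unit j) : ℂ) •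
        defectStar T (tupleAdjPow T (α - unit j) (adjoint (rowOp T) h j)) := by
      rw [gam_eq_sum hα, Nat.cast_sum, Finset.sum_smul]
      refine Finset.sum_congr rfl fun j _ => ?_
      by_cases hj : α j = 0
      · simp [hj]
      · rw [if_neg hj, if_neg hj, adjoint_rowOp_apply]
        conv_lhs => rw [← sub_unit_add_unit hj, tupleAdjPow_add_unit' hc, sub_unit_add_unit hj]
        rfl
    rw [← h2] at h1
    rw [hDD, map_sub, map_sub, smul_right_injective H (hg α) h1, sub_self]
  have key3 : ∀ {α : Fin n → ℕ}, α ≠ 0 → ∀ h,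
      defectStar T (tupleAdjPow T α (defectStar T h)) = 0 := by
    intro α hα
    set D := defectStar T with hD
    set X := D * tupleAdjPow T α * D with hX
    have h1 : X * D = 0 := by ext h; exact key2 hα h
    -- D² is lowered to D: X* begins with the factor D, and XD = 0, so XX* = 0.
    have h2 : X * star X = 0 := by
      have hs : star X = D * (star (tupleAdjPow T α) * D) := by
        rw [hX, star_mul, star_mul, (isSelfAdjoint_defectStar T).star_eq]
      rw [hs, ← mul_assoc, h1, zero_mul]
    have h3 : X = 0 := CStarRing.mul_star_self_eq_zero_iff X |>.1 h2
    intro h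
    exact congrArg (fun A : H →L[ℂ] H => A h) h3
  have key4 : ∀ i h, adjoint (T i) (defectStar T h) = 0 := by
    -- D T^{*α}(T_i^* D h) = D T^{*(α+e_i)} D h = 0 for every α, and these operators separate
    -- points.
    refine fun i h => hsep _ fun α => ?_
    have := key3 (add_unit_ne_zero α i) h
    rwa [tupleAdjPow_add_unit' hc] at this
  have key5 : ∀ i h, defectStar T (T i h) = 0 := by
    intro i h
    refine ext_inner_right ℂ fun v => ?_
    rw [inner_defectStar, ← adjoint_inner_right, key4, inner_zero_right, inner_zero_left]
  refine ⟨hc, ?_, ?_, ?_, hsep⟩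
  · rw [← defectStar_mul_self hT.contraction]
    have h3 : defectStar T * (defectStar T * defectStar T) = defectStar T := by
      ext h
      change defectStar T (defectStar T (defectStar T h)) = _
      rw [hDD]
      simp [key4]
    rw [IsIdempotentElem, mul_assoc, h3]
  · intro α i h
    have := key1 (add_unit_ne_zero α i) i h
    rw [if_neg (add_unit_apply_self_ne_zero α i), add_unit_sub_unit] at this
    exact this.symm
  · intro α i h hi
    by_cases hα : α = 0
    · rw [hα, tupleAdjPow_zero]; exact key5 i h
    · have := key1 hα i h
      rw [if_pos hi] at this
      exact (smul_eq_zero.1 this.symm).resolve_left (hg α)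

namespace IsWold

variable {T : Fin n → H →L[ℂ] H}

theorem defectStar_eq (hT : IsWold T) :
    defectStar T = 1 - rowOp T ∘L adjoint (rowOp T) :=
  defectStar_eq_of_idempotent hT.idem

theorem defectStar_apply (hT : IsWold T) (h : H) :
    defectStar T h = h - ∑ i, T i (adjoint (T i) h) := by
  rw [← rowOp_adjoint_apply]
  exact congrArg (fun A : H →L[ℂ] H => A h) hT.defectStar_eq

theorem defectStar_defectStar (hT : IsWold T) (h : H) :
    defectStar T (defectStar T h) = defectStar T h := by
  have h1 := hT.idem.eq
  rw [← hT.defectStar_eq] at h1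
  exact congrArg (fun A : H →L[ℂ] H => A h) h1

theorem defectStar_comp (hT : IsWold T) (i : Fin n) (h : H) : defectStar T (T i h) = 0 := by
  simpa [tupleAdjPow_zero] using hT.eq_zero 0 i h rfl

theorem adjoint_defectStar (hT : IsWold T) (i : Fin n) (h : H) :
    adjoint (T i) (defectStar T h) = 0 := by
  refine ext_inner_right ℂ fun v => ?_
  rw [adjoint_inner_left, inner_defectStar, hT.defectStar_comp, inner_zero_right, inner_zero_left]

theorem tupleAdjPow_defectStar (hT : IsWold T) {α : Fin n → ℕ} (hα : α ≠ 0) (h : H) :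
    tupleAdjPow T α (defectStar T h) = 0 := by
  obtain ⟨i, hi⟩ : ∃ i, α i ≠ 0 := by
    by_contra! hc
    exact hα (funext hc)
  rw [← sub_unit_add_unit hi, tupleAdjPow_add_unit' hT.comm]
  change tupleAdjPow T _ (adjoint (T i) _) = 0
  rw [hT.adjoint_defectStar, map_zero]

/-- The vectors `T^α w`, `w ∈ ran D_{T*}`, have the Gram matrix of the monomials in the
Drury–Arveson space. -/
theorem defectStar_tupleAdjPow_tuplePow (hT : IsWold T) (α β : Fin n → ℕ) (h : H) :
    defectStar T (tupleAdjPow T α (tuplePow T β (defectStar T h))) =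
      if α = β then (gam α : ℂ)⁻¹ • defectStar T h else 0 := by
  induction β using multiIndex_induction generalizing α with
  | h0 =>
    rw [tuplePow_zero]
    by_cases hα : α = 0
    · subst hα
      simp [gam_zero, tupleAdjPow_zero, hT.defectStar_defectStar]
    · rw [if_neg hα]
      simp [hT.tupleAdjPow_defectStar hα]
  | hs β i ih =>
    rw [tuplePow_add_unit hT.comm]
    change defectStar T (tupleAdjPow T α (T i (tuplePow T β (defectStar T h)))) = _
    by_cases hα : α i = 0
    · rw [hT.eq_zero _ _ _ hα, if_neg]
      rintro rfl
      exact add_unit_apply_self_ne_zero _ _ hα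
    · rw [← sub_unit_add_unit hα]
      set α' := α - unit i
      have hg : ((gam (α' + unit i) : ℕ) : ℂ) ≠ 0 := Nat.cast_ne_zero.2 (gam_pos _).ne'
      have hg' : (gam α' : ℂ) ≠ 0 := Nat.cast_ne_zero.2 (gam_pos _).ne'
      -- Scaling by γ_{α'+e_i} puts the left side in the form of `gam_smul`, which strips one T_i
      -- and lowers both multi-indices by e_i.
      apply smul_right_injective H hg
      change (gam (α' + unit i) : ℂ) • _ = (gam (α' + unit i) : ℂ) • _
      rw [hT.gam_smul, ih]
      simp only [add_left_inj]
      split_ifs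
      · rw [smul_inv_smul₀ hg, smul_inv_smul₀ hg']
      · rw [smul_zero, smul_zero]

theorem inner_tuplePow (hT : IsWold T) (α β : Fin n → ℕ) {x y : H} (hx : defectStar T x = x)
    (hy : defectStar T y = y) :
    ⟪tuplePow T α x, tuplePow T β y⟫_ℂ = if α = β then (gam α : ℂ)⁻¹ * ⟪x, y⟫_ℂ else 0 := by
  rw [← hx, ← hy, ← adjoint_inner_right, adjoint_tuplePow hT.comm, inner_defectStar,
    hT.defectStar_tupleAdjPow_tuplePow, inner_defectStar, hT.defectStar_defectStar]
  split_ifs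
  · rw [inner_smul_right]
  · rw [inner_zero_right]

end IsWold

end Wold

end DruryArveson

namespace DruryArveson

/-! ### Comparison with the Drury–Arveson model -/

section Model

variable {n : ℕ} {H : Type*} [NormedAddCommGroup H] [InnerProductSpace ℂ H] [CompleteSpace H]
variable {W : Type*} [NormedAddCommGroup W] [InnerProductSpace ℂ W]

open ContinuousLinearMap

theorem Coeff.inner_def {α : Fin n → ℕ} (x y : Coeff W α) :
    ⟪x, y⟫_ℂ = (gam α : ℂ)⁻¹ * @inner ℂ W _ x y := rfl

/-! ### Construction of the unitary onto the model -/

/-- The map `w ↦ T^α w` on the coefficient space of `z^α`. -/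
noncomputable def IsWold.monomialIsometry {T : Fin n → H →L[ℂ] H} (hT : IsWold T) (J : W →ₗᵢ[ℂ] H)
    (hJ : ∀ w, defectStar T (J w) = J w) (α : Fin n → ℕ) : Coeff W α →ₗᵢ[ℂ] H :=
  LinearMap.isometryOfInner
    ({ toFun := fun x => tuplePow T α (J x)
       map_add' := fun x y => by
        rw [← map_add]; exact congrArg _ (map_add J (x : W) y)
       map_smul' := fun c x => by
        rw [RingHom.id_apply, ← map_smul]; exact congrArg _ (map_smul J c (x : W)) } :
        Coeff W α →ₗ[ℂ] H)
    (fun x y => by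
      refine (hT.inner_tuplePow α α (hJ x) (hJ y)).trans ?_
      rw [if_pos rfl, Coeff.inner_def]
      exact congrArg _ (J.inner_map_map (x : W) y))

theorem IsWold.monomialIsometry_apply {T : Fin n → H →L[ℂ] H} (hT : IsWold T) (J : W →ₗᵢ[ℂ] H)
    (hJ : ∀ w, defectStar T (J w) = J w) (α : Fin n → ℕ) (x : Coeff W α) :
    hT.monomialIsometry J hJ α x = tuplePow T α (J x) := rfl

/-- The spaces T^α ran D are mutually orthogonal by `IsWold.inner_tuplePow`, and total because a
vector orthogonal to all of them is killed by every D T^{*α}. Keeping W free, with J an isometry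
onto ran D, lets two tuples share one model. -/
theorem IsWold.exists_unitary_shift [CompleteSpace W] {T : Fin n → H →L[ℂ] H} (hT : IsWold T)
    (J : W →ₗᵢ[ℂ] H) (hJ : ∀ w, defectStar T (J w) = J w) (hJ' : ∀ h, ∃ w, J w = defectStar T h) :
    UnitarilyEquivalent T (shift n W) := by
  have hV : OrthogonalFamily ℂ (fun α : Fin n → ℕ => Coeff W α) (hT.monomialIsometry J hJ) := by
    intro α β hαβ x y
    refine (hT.inner_tuplePow α β (hJ x) (hJ y)).trans ?_
    rw [if_neg hαβ]
  have hS : IsHilbertSum ℂ (fun α : Fin n → ℕ => Coeff W α) (hT.monomialIsometry J hJ) := by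
    refine IsHilbertSum.mk hV ?_
    rw [top_le_iff, Submodule.topologicalClosure_eq_top_iff, Submodule.eq_bot_iff]
    intro h hh
    refine hT.separating h fun α => ext_inner_right ℂ fun v => ?_
    obtain ⟨w, hw⟩ := hJ' v
    rw [inner_defectStar, ← hw, ← adjoint_tuplePow hT.comm, adjoint_inner_left, inner_zero_left]
    refine Submodule.inner_left_of_mem_orthogonal ?_ hh
    exact Submodule.mem_iSup_of_mem α ⟨w, rfl⟩
  refine ⟨hS.linearIsometryEquiv, fun i h => ?_⟩
  apply hS.linearIsometryEquiv.symm.injective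
  rw [LinearIsometryEquiv.symm_apply_apply]
  set f := hS.linearIsometryEquiv h with hf
  have h1 := hS.hasSum_linearIsometryEquiv_symm f
  rw [hf, LinearIsometryEquiv.symm_apply_apply, ← hf] at h1
  have h2 := (T i).hasSum h1
  have h3 := hS.hasSum_linearIsometryEquiv_symm (shift n W i f)
  have hinj : Function.Injective fun α : Fin n → ℕ => α + unit i := fun _ _ h => add_right_cancel h
  -- T_i moves the α-th term to index α + e_i; the indices β missed by this map have β_i = 0, where
  -- z_i f has no coefficient.
  rw [← hinj.hasSum_iff] at h3
  · refine h2.unique ?_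
    convert h3 using 1
    funext α
    simp only [Function.comp_apply]
    have h4 : (shift n W i f (α + unit i) : W) = (f α : W) := by
      rw [shift_apply, if_neg (add_unit_apply_self_ne_zero α i), add_unit_sub_unit]
    rw [IsWold.monomialIsometry_apply, IsWold.monomialIsometry_apply]
    refine Eq.trans ?_ (congrArg (fun w : W => tuplePow T (α + unit i) (J w)) h4).symm
    rw [tuplePow_add_unit hT.comm]
    rfl
  · intro β hβ
    have h5 : β i = 0 := by
      by_contra hc
      exact hβ ⟨β - unit i, sub_unit_add_unit hc⟩
    have h4 : shift n W i f β = 0 := (shift_apply i f β).trans (if_pos h5)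
    rw [h4, map_zero]

/-! ### Drury–Arveson shifts -/

/-- The coefficient of `z^α`, as an element of `W`. -/
noncomputable def coeffMap (α : Fin n → ℕ) : HSpace n W →ₗ[ℂ] W where
  toFun f := f α
  map_add' _ _ := rfl
  map_smul' _ _ := rfl

theorem coeffMap_ext {f g : HSpace n W} (h : ∀ α, coeffMap α f = coeffMap α g) : f = g := by
  ext α
  exact h α

theorem coeffMap_shift (β : Fin n → ℕ) (i : Fin n) (f : HSpace n W) :
    coeffMap β (shift n W i f) = if β i = 0 then 0 else coeffMap (β - unit i) f := rfl

theorem inner_single_coeffMap (α : Fin n → ℕ) (w : W) (f : HSpace n W) :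
    ⟪(lp.single 2 α (w : Coeff W α) : HSpace n W), f⟫_ℂ = (gam α : ℂ)⁻¹ * ⟪w, coeffMap α f⟫_ℂ :=
  (lp.inner_single_left (𝕜 := ℂ) (G := fun α => Coeff W α) α w f).trans (Coeff.inner_def _ _)

theorem shift_single (i : Fin n) (α : Fin n → ℕ) (w : W) :
    shift n W i (lp.single 2 α (w : Coeff W α)) =
      (lp.single 2 (α + unit i) (w : Coeff W (α + unit i)) : HSpace n W) := by
  have hs : ∀ α β : Fin n → ℕ, coeffMap β (lp.single 2 α (w : Coeff W α) : HSpace n W) =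
      if β = α then w else 0 := by
    intro α β
    change (lp.single 2 α (w : Coeff W α) : HSpace n W) β = _
    split_ifs with h
    · subst h; exact lp.single_apply_self _ _ _
    · exact lp.single_apply_ne _ _ _ h
  refine coeffMap_ext fun β => ?_
  rw [coeffMap_shift, hs, hs]
  by_cases hβ : β i = 0
  · rw [if_pos hβ, if_neg]
    rintro rfl
    exact add_unit_apply_self_ne_zero _ _ hβ
  · rw [if_neg hβ]
    conv_rhs => rw [← sub_unit_add_unit hβ]
    simp only [add_left_inj]

variable [CompleteSpace W]

/-- Tested against w z^α, the adjoint becomes the shift w z^α ↦ w z^{α+e_i}; the factor is the ratio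
of the weights 1/γ of these monomials. -/
theorem coeffMap_adjoint {T : Fin n → H →L[ℂ] H} (U : H ≃ₗᵢ[ℂ] HSpace n W)
    (hU : ∀ i h, U (T i h) = shift n W i (U h)) (α : Fin n → ℕ) (i : Fin n) (h : H) :
    coeffMap α (U (adjoint (T i) h)) =
      ((gam α : ℂ) / gam (α + unit i)) • coeffMap (α + unit i) (U h) := by
  have hg : (gam α : ℂ) ≠ 0 := Nat.cast_ne_zero.2 (gam_pos _).ne'
  refine ext_inner_left ℂ fun w => ?_
  apply mul_left_cancel₀ (inv_ne_zero hg)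
  rw [← inner_single_coeffMap, inner_smul_right, div_mul_eq_mul_div, mul_div_assoc,
    inv_mul_cancel_left₀ hg, div_eq_inv_mul, ← inner_single_coeffMap, ← shift_single]
  obtain ⟨x, hx⟩ := U.surjective (lp.single 2 α (w : Coeff W α))
  rw [← hx, ← hU, U.inner_map_map, U.inner_map_map, adjoint_inner_right]

theorem IsDruryArvesonShift.isWold {T : Fin n → H →L[ℂ] H} (hT : IsDruryArvesonShift T) :
    IsWold T := by
  obtain ⟨W, _, _, _, U, hU⟩ := hT
  set c : (Fin n → ℕ) → H →ₗ[ℂ] W := fun α => coeffMap α ∘ₗ U.toLinearEquiv.toLinearMap with hc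
  have hext : ∀ {h h' : H}, (∀ α, c α h = c α h') → h = h' := fun hh =>
    U.injective (coeffMap_ext hh)
  have hshift : ∀ β i h, c β (T i h) = if β i = 0 then 0 else c (β - unit i) h := fun β i h => by
    change coeffMap β (U (T i h)) = _
    rw [hU]; rfl
  have hadj : ∀ α i h, c α (adjoint (T i) h) =
      ((gam α : ℂ) / gam (α + unit i)) • c (α + unit i) h := fun α i h =>
    coeffMap_adjoint U hU α i h
  have hg : ∀ α : Fin n → ℕ, (gam α : ℂ) ≠ 0 := fun α => Nat.cast_ne_zero.2 (gam_pos α).ne'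
  have hcomm : ∀ i j, T i ∘L T j = T j ∘L T i := by
    intro i j
    ext h
    refine hext fun α => ?_
    change c α (T i (T j h)) = c α (T j (T i h))
    rw [hshift, hshift, hshift, hshift]
    by_cases hij : i = j
    · rw [hij]
    · have hji : ¬ j = i := fun h => hij h.symm
      have h1 : (α - unit i) j = α j := by simp [unit, hji]
      have h2 : (α - unit j) i = α i := by simp [unit, hij]
      rw [h1, h2, tsub_right_comm]
      split_ifs <;> rfl
  -- I - TT* is the projection onto the constants: for β ≠ 0 the weights γ_{β-e_i}/γ_β sum to 1 by
  -- Pascal's rule.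
  have hX : ∀ β h, c β ((1 - rowOp T ∘L adjoint (rowOp T)) h) = if β = 0 then c β h else 0 := by
    intro β h
    change c β (h - rowOp T (adjoint (rowOp T) h)) = _
    rw [rowOp_adjoint_apply, map_sub, map_sum]
    simp_rw [hshift]
    split_ifs with hβ
    · subst hβ; simp
    · have h1 : ∀ i, (if β i = 0 then 0 else c (β - unit i) (adjoint (T i) h)) =
          (((if β i = 0 then 0 else gam (β - unit i) : ℕ) : ℂ) / gam β) • c β h := by
        intro i
        split_ifs with hi
        · simp
        · rw [hadj, sub_unit_add_unit hi]
      simp_rw [h1]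
      rw [← Finset.sum_smul, ← Finset.sum_div, ← Nat.cast_sum, ← gam_eq_sum hβ, div_self (hg β),
        one_smul, sub_self]
  have hidem : IsIdempotentElem (1 - rowOp T ∘L adjoint (rowOp T)) := by
    ext h
    refine hext fun β => ?_
    change c β ((1 - rowOp T ∘L adjoint (rowOp T)) ((1 - rowOp T ∘L adjoint (rowOp T)) h)) = _
    rw [hX, hX]
    split_ifs <;> rfl
  have hpow : ∀ α β h, c β (tupleAdjPow T α h) = ((gam β : ℂ) / gam (α + β)) • c (α + β) h := by
    intro α
    induction α using multiIndex_induction with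
    | h0 =>
      intro β h
      rw [tupleAdjPow_zero, zero_add, div_self (hg β), one_smul]
      rfl
    | hs α i ih =>
      intro β h
      rw [tupleAdjPow_add_unit hcomm]
      change c β (adjoint (T i) (tupleAdjPow T α h)) = _
      rw [hadj, ih, smul_smul, div_mul_div_cancel₀ (hg _), add_right_comm α, add_assoc α]
  -- D T^{*α} reads off the α-th coefficient up to 1/γ_α, so the remaining conditions become the
  -- coefficient rule for z_i f and uniqueness of coefficients.
  have hD : ∀ α β h, c β (defectStar T (tupleAdjPow T α h)) =
      if β = 0 then (gam α : ℂ)⁻¹ • c α h else 0 := by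
    intro α β h
    rw [defectStar_eq_of_idempotent hidem, hX]
    split_ifs with hβ
    · rw [hβ, hpow, gam_zero, add_zero, Nat.cast_one, one_div]
    · rfl
  refine ⟨hcomm, hidem, fun α i h => ?_, fun α i h hi => ?_, fun h hh => ?_⟩
  · refine hext fun β => ?_
    rw [map_smul, map_smul, hD, hD]
    split_ifs
    · rw [smul_inv_smul₀ (hg _), smul_inv_smul₀ (hg _), hshift,
        if_neg (add_unit_apply_self_ne_zero α i), add_unit_sub_unit]
    · rw [smul_zero, smul_zero]
  · refine hext fun β => ?_
    rw [hD, hshift, if_pos hi, smul_zero, ite_self, map_zero]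
  · refine hext fun α => ?_
    have h1 := hD α 0 h
    rw [hh, map_zero, if_pos rfl] at h1
    rw [map_zero]
    exact (smul_eq_zero.1 h1.symm).resolve_left (inv_ne_zero (hg α))

end Model

end DruryArveson

namespace DruryArveson

/-! ### Regularity and the invariant of Wold-type tuples -/

section Invariants

variable {n : ℕ} {H : Type*} [NormedAddCommGroup H] [InnerProductSpace ℂ H] [CompleteSpace H]

open ContinuousLinearMap

/-! ### Regularity -/

theorem prod_pow_add_unit (z : Fin n → ℂ) (α : Fin n → ℕ) (i : Fin n) :
    ∏ j, z j ^ (α + unit i) j = z i * ∏ j, z j ^ α j := by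
  simp_rw [Pi.add_apply, pow_add, Finset.prod_mul_distrib]
  rw [mul_comm]
  congr 1
  rw [Finset.prod_eq_single i]
  · simp [unit]
  · intro j _ hj; simp [unit, hj]
  · simp

/-- The multinomial theorem for the commuting operators z_i T_i^*, by splitting off one factor and
applying Pascal's rule. -/
theorem defectStar_pow_apply {T : Fin n → H →L[ℂ] H} (hc : ∀ i j, T i ∘L T j = T j ∘L T i)
    (z : Fin n → ℂ) (k : ℕ) (h : H) :
    defectStar T (((∑ i, z i • adjoint (T i)) ^ k : H →L[ℂ] H) h) =
      ∑ α ∈ Finset.piAntidiag (Finset.univ : Finset (Fin n)) k,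
        ((gam α : ℂ) * ∏ j, z j ^ α j) • defectStar T (tupleAdjPow T α h) := by
  induction k generalizing h with
  | zero =>
    rw [piAntidiag_univ_zero, Finset.sum_singleton, gam_zero, tupleAdjPow_zero]
    simp
  | succ k ih =>
    have h1 : ((∑ i, z i • adjoint (T i)) ^ (k + 1) : H →L[ℂ] H) h =
        ((∑ i, z i • adjoint (T i)) ^ k : H →L[ℂ] H) (∑ i, z i • adjoint (T i) h) := by
      rw [pow_succ]
      simp [ContinuousLinearMap.mul_def]
    rw [h1, ih]
    have h2 : ∀ α : Fin n → ℕ, ((gam α : ℂ) * ∏ j, z j ^ α j) •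
          defectStar T (tupleAdjPow T α (∑ i, z i • adjoint (T i) h)) =
        ∑ i, ((gam α : ℂ) * ∏ j, z j ^ (α + unit i) j) •
          defectStar T (tupleAdjPow T (α + unit i) h) := by
      intro α
      rw [map_sum, map_sum, Finset.smul_sum]
      refine Finset.sum_congr rfl fun i _ => ?_
      rw [map_smul, map_smul, smul_smul, prod_pow_add_unit, tupleAdjPow_add_unit' hc, mul_assoc,
        mul_comm (z i)]
      rfl
    simp_rw [h2]
    rw [← sum_piAntidiag_succ k fun α i => ((gam α : ℂ) * ∏ j, z j ^ (α + unit i) j) •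
          defectStar T (tupleAdjPow T (α + unit i) h)]
    refine Finset.sum_congr rfl fun β hβ => ?_
    have hβ0 : β ≠ 0 := by
      rintro rfl
      have h1 : len (0 : Fin n → ℕ) = k + 1 := (Finset.mem_piAntidiag.1 hβ).1
      rw [len_zero] at h1
      omega
    rw [gam_eq_sum hβ0, Nat.cast_sum, Finset.sum_mul, Finset.sum_smul]
    refine Finset.sum_congr rfl fun j _ => ?_
    by_cases hj : β j = 0
    · simp [hj]
    · rw [if_neg hj, if_neg hj, sub_unit_add_unit hj]

theorem adjoint_cfcSqrt (A : H →L[ℂ] H) : adjoint (CFC.sqrt A) = CFC.sqrt A :=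
  (CFC.sqrt_nonneg A).isSelfAdjoint.adjoint_eq

namespace IsWold

variable {T : Fin n → H →L[ℂ] H}

/-- In the model, D S^k with S = Σ z_i T_i^* evaluates the homogeneous part of degree k at z; this
is the rule for multiplication by the i-th coordinate. -/
theorem defectStar_pow_succ_apply (hT : IsWold T) (z : Fin n → ℂ) (k : ℕ) (i : Fin n) (h : H) :
    defectStar T (((∑ i, z i • adjoint (T i)) ^ (k + 1) : H →L[ℂ] H) (T i h)) =
      z i • defectStar T (((∑ i, z i • adjoint (T i)) ^ k : H →L[ℂ] H) h) := by
  rw [defectStar_pow_apply hT.comm, defectStar_pow_apply hT.comm, Finset.smul_sum]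
  have h1 : ∀ α : Fin n → ℕ, z i • ((gam α : ℂ) * ∏ j, z j ^ α j) •
        defectStar T (tupleAdjPow T α h) =
      ∑ j, if j = i then ((∏ l, z l ^ (α + unit j) l) * (gam α : ℂ)) •
        defectStar T (tupleAdjPow T α h) else 0 := by
    intro α
    rw [Finset.sum_ite_eq' Finset.univ i, if_pos (Finset.mem_univ _), prod_pow_add_unit, smul_smul]
    congr 1
    ring
  simp_rw [h1]
  rw [← sum_piAntidiag_succ k fun α j => if j = i then
    ((∏ l, z l ^ (α + unit j) l) * (gam α : ℂ)) • defectStar T (tupleAdjPow T α h) else 0]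
  refine Finset.sum_congr rfl fun β _ => ?_
  rw [Finset.sum_eq_single i]
  · by_cases hi : β i = 0
    · rw [if_pos hi, hT.eq_zero _ _ _ hi, smul_zero]
    · rw [if_neg hi, if_pos rfl, sub_unit_add_unit hi, mul_comm, mul_smul, mul_smul,
        ← hT.gam_smul (β - unit i), sub_unit_add_unit hi]
  · intro j _ hj
    simp [hj]
  · simp

theorem mem_orthogonal_iSup_range_iff (hT : IsWold T) {h : H} :
    h ∈ (⨆ i, LinearMap.range (T i).toLinearMap)ᗮ ↔ defectStar T h = h := by
  rw [← Submodule.iInf_orthogonal, Submodule.mem_iInf]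
  constructor
  · intro hh
    rw [hT.defectStar_apply, Finset.sum_eq_zero fun i _ => ?_, sub_zero]
    have h1 : adjoint (T i) h = 0 := by
      refine ext_inner_right ℂ fun v => ?_
      rw [adjoint_inner_left, inner_zero_left]
      have hv : T i v ∈ LinearMap.range (T i).toLinearMap := ⟨v, rfl⟩
      exact Submodule.inner_left_of_mem_orthogonal hv (hh i)
    rw [h1, map_zero]
  · intro hh i
    rw [Submodule.mem_orthogonal]
    rintro _ ⟨v, rfl⟩
    change ⟪T i v, h⟫_ℂ = 0
    rw [← adjoint_inner_right, ← hh, hT.adjoint_defectStar, inner_zero_right]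

/-- In the model, E = D(I - S)⁻¹ is evaluation at z. Since ED = D and DE = E, it is a bounded
projection onto ran D, the complement in the definition of regularity, and its kernel is (T - Z)H^n.
-/
theorem isRegular (hT : IsWold T) : IsRegular T := by
  set M := ∑ i, ‖T i‖ with hM
  have hM0 : 0 ≤ M := Finset.sum_nonneg fun _ _ => norm_nonneg _
  -- As ‖S‖ ≤ ‖z‖M, this radius makes the Neumann series for (I - S)⁻¹ converge; the summand 1
  -- covers M = 0.
  refine ⟨(M + 1)⁻¹, by positivity, fun z hz => ?_⟩
  set S : H →L[ℂ] H := ∑ i, z i • adjoint (T i) with hS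
  have hSn : ‖S‖ < 1 := by
    calc ‖S‖ ≤ ∑ i, ‖z‖ * ‖T i‖ := by
          refine norm_sum_le_of_le _ fun i _ => ?_
          rw [norm_smul, LinearIsometryEquiv.norm_map]
          exact mul_le_mul_of_nonneg_right (PiLp.norm_apply_le z i) (norm_nonneg _)
      _ = ‖z‖ * M := by rw [Finset.mul_sum]
      _ ≤ (M + 1)⁻¹ * M := mul_le_mul_of_nonneg_right hz.le hM0
      _ < 1 := by rw [inv_mul_lt_one₀ (by positivity)]; linarith
  have hsum : Summable fun k : ℕ => S ^ k := summable_geometric_of_norm_lt_one hSn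
  set R : H →L[ℂ] H := ∑' k : ℕ, S ^ k with hR
  have hR1 : R * (1 - S) = 1 := geom_series_mul_neg S hSn
  have hR2 : (1 - S) * R = 1 := mul_neg_geom_series S hSn
  set E : H →L[ℂ] H := defectStar T * R with hE
  have hsumD : Summable fun k : ℕ => defectStar T * S ^ k := hsum.mul_left _
  have hED : E = ∑' k : ℕ, defectStar T * S ^ k := (hsum.tsum_mul_left _).symm
  have hET : ∀ i, E * T i = z i • E := by
    intro i
    -- The constant term drops out because D T_i = 0; the remaining terms of the series for E T_i
    -- are z_i times those for E.
    have h0 : defectStar T * S ^ 0 * T i = 0 := by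
      ext h
      rw [pow_zero, mul_one]
      exact hT.defectStar_comp i h
    have hs : ∀ k, defectStar T * S ^ (k + 1) * T i = z i • (defectStar T * S ^ k) := fun k => by
      ext h
      exact hT.defectStar_pow_succ_apply z k i h
    rw [hED, ← hsumD.tsum_mul_right, (hsumD.mul_right (T i)).tsum_eq_zero_add, h0, zero_add]
    simp_rw [hs]
    exact hsumD.tsum_const_smul _
  have hrange : ∀ f, f ∈ LinearMap.range (rowOp fun i => T i - z i • (1 : H →L[ℂ] H)).toLinearMap ↔
      E f = 0 := by
    intro f
    constructor
    · rintro ⟨x, rfl⟩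
      change E (rowOp _ x) = 0
      rw [rowOp_apply, map_sum]
      refine Finset.sum_eq_zero fun i _ => ?_
      have h1 : E (T i (x i)) = z i • E (x i) := congrArg (fun A : H →L[ℂ] H => A (x i)) (hET i)
      change E (T i (x i) - z i • x i) = 0
      rw [map_sub, h1, map_smul, sub_self]
    · intro hf
      -- D R f = 0 says R f = Σ T_i T_i^* R f, so Σ (T_i - z_i) T_i^* R f = (I - S) R f = f.
      refine ⟨adjoint (rowOp T) (R f), ?_⟩
      change rowOp _ _ = f
      rw [rowOp_apply]
      simp_rw [adjoint_rowOp_apply]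
      have h1 : defectStar T (R f) = 0 := hf
      rw [hT.defectStar_apply, sub_eq_zero] at h1
      have h2 : R f - S (R f) = f := congrArg (fun A : H →L[ℂ] H => A f) hR2
      have h3 : S (R f) = ∑ i, z i • adjoint (T i) (R f) := by
        simp [hS]
      calc ∑ i, (T i - z i • (1 : H →L[ℂ] H)) (adjoint (T i) (R f))
          = ∑ i, (T i (adjoint (T i) (R f)) - z i • adjoint (T i) (R f)) := rfl
        _ = R f - S (R f) := by rw [Finset.sum_sub_distrib, ← h1, ← h3]
        _ = f := h2
  have hEfix : ∀ h, E (defectStar T h) = defectStar T h := by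
    intro h
    have h1 : S (defectStar T h) = 0 := by
      simp [hS, hT.adjoint_defectStar]
    have h2 : R (defectStar T h - S (defectStar T h)) = defectStar T h :=
      congrArg (fun A : H →L[ℂ] H => A (defectStar T h)) hR1
    rw [h1, sub_zero] at h2
    change defectStar T (R (defectStar T h)) = _
    rw [h2, hT.defectStar_defectStar]
  have hDE : ∀ h, defectStar T (E h) = E h := fun h => hT.defectStar_defectStar _
  refine ⟨?_, ?_⟩
  · have : Set.range (rowOp fun i => T i - z i • (1 : H →L[ℂ] H)) = {f | E f = 0} :=
      Set.ext hrange
    rw [this]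
    exact isClosed_eq E.continuous continuous_const
  · rw [isCompl_iff, Submodule.disjoint_def, codisjoint_iff, Submodule.eq_top_iff']
    refine ⟨fun x hx hx' => ?_, fun x => ?_⟩
    · rw [hT.mem_orthogonal_iSup_range_iff] at hx'
      rw [hrange] at hx
      rw [← hx', ← hEfix, hx', hx]
    · rw [Submodule.mem_sup]
      refine ⟨x - E x, ?_, E x, ?_, sub_add_cancel _ _⟩
      · rw [hrange, map_sub, ← hDE, hEfix, hDE, sub_self]
      · rw [hT.mem_orthogonal_iSup_range_iff, hDE]

/-! ### The characteristic function -/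

/-- The adjoint D_T T* vanishes, since D_T² T* = T*(I - TT*) = T*D = 0 and D_T is self-adjoint. -/
theorem rowOp_defect (hT : IsWold T) (hn : ‖rowOp T‖ ≤ 1) (y : Pow n H) :
    rowOp T (defect T y) = 0 := by
  have hsa : adjoint (defect T) = defect T := adjoint_cfcSqrt _
  have h1 : ∀ h, defect T (adjoint (rowOp T) h) = 0 := by
    intro h
    have h2 : defect T (defect T (adjoint (rowOp T) h)) = 0 := by
      have h3 : defect T (defect T (adjoint (rowOp T) h)) =
          adjoint (rowOp T) (h - rowOp T (adjoint (rowOp T) h)) := by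
        rw [map_sub]
        exact congrArg (fun A : Pow n H →L[ℂ] Pow n H => A (adjoint (rowOp T) h)) (defect_mul_self hn)
      rw [h3, rowOp_adjoint_apply, ← hT.defectStar_apply]
      ext i
      rw [adjoint_rowOp_apply, hT.adjoint_defectStar]
      rfl
    rw [← inner_self_eq_zero (𝕜 := ℂ), ← adjoint_inner_right, hsa, h2, inner_zero_right]
  refine ext_inner_right ℂ fun v => ?_
  rw [← adjoint_inner_right, ← adjoint_inner_right, hsa, h1, inner_zero_right, inner_zero_left]

/-- The Wold identities collapse θ_{T,α} x to γ_α D T^{*α} T D_T x, and T D_T = 0. -/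
theorem charDegree_eq_zero (hT : IsWold T) (hn : ‖rowOp T‖ ≤ 1) : charDegree T = 0 := by
  refine DruryArveson.charDegree_eq_zero fun α hα => ?_
  ext x
  rw [charCoeff_apply hα]
  have h1 : ∀ j, (if α j = 0 then (0 : H) else (gam (α - unit j) : ℂ) •
      defectStar T (tupleAdjPow T (α - unit j) (defect T (x : Pow n H) j))) =
      (gam α : ℂ) • defectStar T (tupleAdjPow T α (T j (defect T (x : Pow n H) j))) := by
    intro j
    by_cases hj : α j = 0
    · rw [if_pos hj, hT.eq_zero _ _ _ hj, smul_zero]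
    · rw [if_neg hj, ← hT.gam_smul, sub_unit_add_unit hj]
  simp_rw [h1]
  rw [← Finset.smul_sum, ← map_sum, ← map_sum, ← rowOp_apply, hT.rowOp_defect hn, map_zero,
    map_zero, smul_zero]
  rfl

theorem mem_orthogonal_tailSpace_iff (hT : IsWold T) {m : ℕ} {h : H} :
    h ∈ (tailSpace T m)ᗮ ↔ ∀ α, m ≤ len α → defectStar T (tupleAdjPow T α h) = 0 := by
  rw [tailSpace, Submodule.orthogonal_closure, Submodule.mem_orthogonal]
  have h0 : ∀ α v, ⟪tuplePow T α (defectStar T v), h⟫_ℂ =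
      ⟪v, defectStar T (tupleAdjPow T α h)⟫_ℂ := fun α v => by
    rw [← adjoint_inner_right, adjoint_tuplePow hT.comm, inner_defectStar]
  constructor
  · intro hh α hα
    refine ext_inner_left ℂ fun v => ?_
    rw [← h0, inner_zero_right]
    exact hh _ (Submodule.subset_span ⟨α, v, hα, rfl⟩)
  · intro hh u hu
    induction hu using Submodule.span_induction with
    | mem x hx =>
      obtain ⟨α, v, hα, rfl⟩ := hx
      rw [h0, hh α hα, inner_zero_right]
    | zero => exact inner_zero_left _
    | add x y _ _ hx hy => rw [inner_add_left, hx, hy, add_zero]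
    | smul a x _ hx => rw [inner_smul_left, hx, mul_zero]

theorem tailSpace_zero (hT : IsWold T) : tailSpace T 0 = ⊤ := by
  rw [← Submodule.orthogonal_eq_bot_iff, Submodule.eq_bot_iff]
  intro h hh
  exact hT.separating h fun α => hT.mem_orthogonal_tailSpace_iff.1 hh α (Nat.zero_le _)

theorem mem_range_defectStar_iff (hT : IsWold T) {h : H} :
    h ∈ LinearMap.range (defectStar T).toLinearMap ↔ defectStar T h = h := by
  constructor
  · rintro ⟨v, rfl⟩
    exact hT.defectStar_defectStar v
  · intro hh
    exact ⟨h, hh⟩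

theorem orthogonal_tailSpace_one (hT : IsWold T) :
    (tailSpace T 1)ᗮ = LinearMap.range (defectStar T).toLinearMap := by
  ext h
  rw [hT.mem_orthogonal_tailSpace_iff, hT.mem_range_defectStar_iff]
  constructor
  · intro hh
    symm
    rw [← sub_eq_zero]
    -- h and Dh have the same constant coefficient, and every other coefficient of either one is
    -- zero.
    refine hT.separating _ fun α => ?_
    rw [map_sub, map_sub]
    by_cases hα : α = 0
    · subst hα
      rw [tupleAdjPow_zero]
      change defectStar T h - defectStar T (defectStar T h) = 0
      rw [hT.defectStar_defectStar, sub_self]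
    · rw [hT.tupleAdjPow_defectStar hα, map_zero, sub_zero]
      exact hh α (Nat.one_le_iff_ne_zero.2 fun h0 => hα (len_eq_zero.1 h0))
  · intro hh α hα
    have hα0 : α ≠ 0 := by
      rintro rfl
      rw [len_zero] at hα
      omega
    rw [← hh, hT.tupleAdjPow_defectStar hα0, map_zero]

theorem phi_eq (hT : IsWold T) (hc : IsCommutingRowContraction T) :
    phi T = (rankENat (defectStar T), 0, 0) := by
  have h0 := hT.charDegree_eq_zero hc.contraction
  have h1 : multiplicity T = rankENat (defectStar T) := by
    rw [multiplicity, h0]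
    change dimENat (tailSpace T 0 ⊓ (tailSpace T 1)ᗮ) = _
    rw [hT.tailSpace_zero, top_inf_eq, hT.orthogonal_tailSpace_one]
    rfl
  rw [phi, h1, h0, dimENat_eq_zero.2 (coisometricPart_eq_bot hc hT.separating)]

theorem shiftBlock_zero_unitarilyEquivalent (hT : IsWold T) :
    UnitarilyEquivalent (shiftBlock T 0) T := by
  refine ⟨LinearIsometryEquiv.ofTop H (tailSpace T 0) hT.tailSpace_zero, fun i h => ?_⟩
  have hm : T i h ∈ tailSpace T 0 := Submodule.eq_top_iff'.1 hT.tailSpace_zero _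
  exact congrArg Subtype.val
    (Submodule.orthogonalProjectionOnto_mem_subspace_eq_self (⟨T i h, hm⟩ : tailSpace T 0))

end IsWold

end Invariants

end DruryArveson

namespace DruryArveson

/-! ### Hilbert spaces of equal dimension -/

section Dimension

variable {E : Type*} [NormedAddCommGroup E] [InnerProductSpace ℂ E] [CompleteSpace E]
variable {F : Type*} [NormedAddCommGroup F] [InnerProductSpace ℂ F] [CompleteSpace F]

theorem exists_hilbertBasis_nat [TopologicalSpace.SeparableSpace E]
    (hE : ¬ Module.Finite ℂ E) : Nonempty (HilbertBasis ℕ ℂ E) := by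
  obtain ⟨w, b, hb⟩ := exists_hilbertBasis ℂ E
  have hw : Countable w := by
    have hs : ∀ i j : w, i ≠ j → 1 ≤ dist (b i) (b j) := by
      intro i j hij
      have h1 := norm_sub_sq (𝕜 := ℂ) (b i) (b j)
      rw [b.orthonormal.1, b.orthonormal.1, b.orthonormal.2 hij, map_zero] at h1
      rw [dist_eq_norm]
      -- The distance is √2; the bound 1 already makes the balls of radius 1/2 disjoint, so
      -- separability leaves only countably many.
      nlinarith [norm_nonneg (b i - b j)]
    refine Pairwise.countable_of_isOpen_disjoint (s := fun i => Metric.ball (b i) (1 / 2))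
      (fun i j hij => Metric.ball_disjoint_ball ?_) (fun _ => Metric.isOpen_ball)
      (fun i => ⟨b i, Metric.mem_ball_self (by norm_num)⟩)
    norm_num
    exact hs i j hij
  have hw' : Infinite w := by
    by_contra hf
    rw [not_infinite_iff_finite] at hf
    have := Fintype.ofFinite w
    exact hE (Module.Finite.of_basis b.toOrthonormalBasis.toBasis)
  obtain ⟨e⟩ : Nonempty (ℕ ≃ w) := nonempty_equiv_of_countable
  refine ⟨HilbertBasis.mk (v := b ∘ e) (b.orthonormal.comp e e.injective) ?_⟩
  rw [Set.range_comp, e.range_eq_univ, Set.image_univ, b.dense_span]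

/-- In ℕ∞ all infinite ranks coincide, so separability must supply bases indexed by ℕ; the algebraic
rank then serves only to exclude finite dimension. -/
theorem exists_linearIsometryEquiv_of_toENat_rank_eq
    (h : Cardinal.toENat (Module.rank ℂ E) = Cardinal.toENat (Module.rank ℂ F))
    (hs : Cardinal.toENat (Module.rank ℂ E) = ⊤ →
      TopologicalSpace.SeparableSpace E ∧ TopologicalSpace.SeparableSpace F) :
    Nonempty (E ≃ₗᵢ[ℂ] F) := by
  by_cases ht : Cardinal.toENat (Module.rank ℂ E) = ⊤
  · obtain ⟨_, _⟩ := hs ht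
    have hE : ¬ Module.Finite ℂ E := by
      rw [← Module.rank_lt_aleph0_iff, not_lt]; exact Cardinal.toENat_eq_top.1 ht
    have hF : ¬ Module.Finite ℂ F := by
      rw [← Module.rank_lt_aleph0_iff, not_lt]; exact Cardinal.toENat_eq_top.1 (h ▸ ht)
    obtain ⟨b⟩ := exists_hilbertBasis_nat hE
    obtain ⟨c⟩ := exists_hilbertBasis_nat hF
    exact ⟨b.repr.trans c.repr.symm⟩
  · have hE : Module.Finite ℂ E := by
      rw [← Module.rank_lt_aleph0_iff, ← not_le]; exact fun hc => ht (Cardinal.toENat_eq_top.2 hc)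
    have hF : Module.Finite ℂ F := by
      rw [← Module.rank_lt_aleph0_iff, ← not_le]
      exact fun hc => ht (h ▸ Cardinal.toENat_eq_top.2 hc)
    have hfr : Module.finrank ℂ E = Module.finrank ℂ F := by
      simpa [Module.finrank] using congrArg ENat.toNat h
    exact ⟨(stdOrthonormalBasis ℂ E).equiv (stdOrthonormalBasis ℂ F) (finCongr hfr)⟩

end Dimension

section Classification

variable {n : ℕ} {H : Type*} [NormedAddCommGroup H] [InnerProductSpace ℂ H] [CompleteSpace H]
variable {H' : Type*} [NormedAddCommGroup H'] [InnerProductSpace ℂ H'] [CompleteSpace H']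

/-! ### Classification -/

theorem UnitarilyEquivalent.symm {T : Fin n → H →L[ℂ] H} {T' : Fin n → H' →L[ℂ] H'}
    (h : UnitarilyEquivalent T T') : UnitarilyEquivalent T' T := by
  obtain ⟨U, hU⟩ := h
  refine ⟨U.symm, fun i x => ?_⟩
  apply U.injective
  rw [hU, U.apply_symm_apply, U.apply_symm_apply]

theorem UnitarilyEquivalent.trans {H'' : Type*} [NormedAddCommGroup H'']
    [InnerProductSpace ℂ H''] {T : Fin n → H →L[ℂ] H} {T' : Fin n → H' →L[ℂ] H'}
    {T'' : Fin n → H'' →L[ℂ] H''} (h : UnitarilyEquivalent T T')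
    (h' : UnitarilyEquivalent T' T'') : UnitarilyEquivalent T T'' := by
  obtain ⟨U, hU⟩ := h
  obtain ⟨V, hV⟩ := h'
  exact ⟨U.trans V, fun i x => by
    rw [LinearIsometryEquiv.trans_apply, LinearIsometryEquiv.trans_apply, hU, hV]⟩

namespace IsWold

variable {T : Fin n → H →L[ℂ] H} {T' : Fin n → H' →L[ℂ] H'}

theorem completeSpace_range_defectStar (hT : IsWold T) :
    CompleteSpace (LinearMap.range (defectStar T).toLinearMap) := by
  refine IsClosed.completeSpace_coe (hs := ?_)
  have : ((LinearMap.range (defectStar T).toLinearMap : Submodule ℂ H) : Set H) =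
      {h | defectStar T h = h} := Set.ext fun h => hT.mem_range_defectStar_iff
  rw [this]
  exact isClosed_eq (defectStar T).continuous continuous_id

theorem unitarilyEquivalent_shift (hT : IsWold T) {W : Type*} [NormedAddCommGroup W]
    [InnerProductSpace ℂ W] [CompleteSpace W]
    (V : W ≃ₗᵢ[ℂ] LinearMap.range (defectStar T).toLinearMap) :
    UnitarilyEquivalent T (shift n W) :=
  hT.exists_unitary_shift
    ((LinearMap.range (defectStar T).toLinearMap).subtypeₗᵢ.comp V.toLinearIsometry)
    (fun w => hT.mem_range_defectStar_iff.1 (V w).2)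
    (fun h => ⟨V.symm ⟨defectStar T h, h, rfl⟩, by simp⟩)

theorem isDruryArvesonShift (hT : IsWold T) : IsDruryArvesonShift T :=
  have := hT.completeSpace_range_defectStar
  ⟨LinearMap.range (defectStar T).toLinearMap, inferInstance, inferInstance, this,
    hT.unitarilyEquivalent_shift (LinearIsometryEquiv.refl ℂ _)⟩

/-- Here m = 0 and 𝒟_0 = H, so the block tuple is unitarily equivalent to T. It is therefore itself
a Drury–Arveson shift, hence regular. -/
theorem isCanonicallyRegular (hT : IsWold T) (hn : ‖rowOp T‖ ≤ 1) : IsCanonicallyRegular T := by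
  refine ⟨0, by rw [hT.charDegree_eq_zero hn]; rfl, ?_⟩
  obtain ⟨W, _, _, _, hW⟩ := hT.isDruryArvesonShift
  have h : IsDruryArvesonShift (shiftBlock T 0) :=
    ⟨W, _, _, inferInstance, hT.shiftBlock_zero_unitarilyEquivalent.trans hW⟩
  exact h.isWold.isRegular

theorem unitarilyEquivalent (hT : IsWold T) (hT' : IsWold T')
    (h : rankENat (defectStar T) = rankENat (defectStar T'))
    (hs : rankENat (defectStar T) = ⊤ →
      TopologicalSpace.SeparableSpace H ∧ TopologicalSpace.SeparableSpace H') :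
    UnitarilyEquivalent T T' := by
  have := hT.completeSpace_range_defectStar
  have := hT'.completeSpace_range_defectStar
  obtain ⟨V⟩ := exists_linearIsometryEquiv_of_toENat_rank_eq h fun ht => by
    obtain ⟨_, _⟩ := hs ht
    -- Separability passes to the defect ranges through second countability.
    have := UniformSpace.secondCountable_of_separable H
    have := UniformSpace.secondCountable_of_separable H'
    exact ⟨inferInstance, inferInstance⟩
  exact (hT.unitarilyEquivalent_shift (LinearIsometryEquiv.refl ℂ _)).trans
    (hT'.unitarilyEquivalent_shift V).symm

end IsWold

theorem isWold_of_phi_eq {T : Fin n → H →L[ℂ] H} (hT : IsCommutingRowContraction T) {p : ℕ∞}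
    (h : phi T = (p, 0, 0)) : IsWold T := by
  simp only [phi, Prod.mk.injEq] at h
  exact isWold_of_charDegree_eq_zero hT h.2.1 (dimENat_eq_zero.1 h.2.2)

theorem isDruryArvesonShift_iff_isWold {T : Fin n → H →L[ℂ] H} :
    IsDruryArvesonShift T ↔ IsWold T :=
  ⟨IsDruryArvesonShift.isWold, IsWold.isDruryArvesonShift⟩

theorem isWold_iff_phi_mem {T : Fin n → H →L[ℂ] H} (hT : IsCommutingRowContraction T) :
    IsWold T ↔ phi T ∈ (Set.univ ×ˢ {0} ×ˢ {0} : Set (ℕ∞ × ℕ∞ × ℕ∞)) := by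
  constructor
  · intro h
    rw [h.phi_eq hT]
    simp
  · intro h
    refine isWold_of_phi_eq hT (p := (phi T).1) ?_
    obtain ⟨_, h1, h2⟩ := h
    exact Prod.ext rfl (Prod.ext h1 h2)

end Classification

end DruryArveson

theorem mainTheorem12 {n : ℕ}
    {H : Type*} [NormedAddCommGroup H] [InnerProductSpace ℂ H] [CompleteSpace H]
    {H' : Type*} [NormedAddCommGroup H'] [InnerProductSpace ℂ H'] [CompleteSpace H']
    (T : Fin n → H →L[ℂ] H) (T' : Fin n → H' →L[ℂ] H')
    (hT : DruryArveson.IsCommutingRowContraction T)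
    (hT' : DruryArveson.IsCommutingRowContraction T') :
    ((DruryArveson.IsDruryArvesonShift T ↔
        DruryArveson.IsRegular T ∧
          DruryArveson.phi T ∈ (Set.univ ×ˢ {0} ×ˢ {0} : Set (ℕ∞ × ℕ∞ × ℕ∞))) ∧
      (DruryArveson.IsDruryArvesonShift T ↔
        DruryArveson.IsCanonicallyRegular T ∧
          DruryArveson.phi T ∈ (Set.univ ×ˢ {0} ×ˢ {0} : Set (ℕ∞ × ℕ∞ × ℕ∞)))) ∧
    (∀ p : ℕ∞,
      (DruryArveson.IsRegular T ∨ DruryArveson.IsCanonicallyRegular T) →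
      (DruryArveson.IsRegular T' ∨ DruryArveson.IsCanonicallyRegular T') →
      DruryArveson.phi T = (p, 0, 0) → DruryArveson.phi T' = (p, 0, 0) →
      ((p = ⊤ → TopologicalSpace.SeparableSpace H ∧ TopologicalSpace.SeparableSpace H') →
        DruryArveson.UnitarilyEquivalent T T') ∧
      DruryArveson.rankENat (DruryArveson.defectStar T) = p ∧
      DruryArveson.rankENat (DruryArveson.defectStar T') = p) := by
  -- Both the shift property and the condition on φ become `IsWold`, leaving in (i) only that it
  -- implies either form of regularity.
  rw [DruryArveson.isDruryArvesonShift_iff_isWold, ← DruryArveson.isWold_iff_phi_mem hT]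
  refine ⟨⟨⟨fun h => ⟨h.isRegular, h⟩, And.right⟩,
    ⟨fun h => ⟨h.isCanonicallyRegular hT.contraction, h⟩, And.right⟩⟩, ?_⟩
  intro p _ _ hp hp'
  have hw := DruryArveson.isWold_of_phi_eq hT hp
  have hw' := DruryArveson.isWold_of_phi_eq hT' hp'
  have h1 : DruryArveson.rankENat (DruryArveson.defectStar T) = p :=
    congrArg Prod.fst ((hw.phi_eq hT).symm.trans hp)
  have h2 : DruryArveson.rankENat (DruryArveson.defectStar T') = p :=
    congrArg Prod.fst ((hw'.phi_eq hT').symm.trans hp')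
  exact ⟨fun hs => hw.unitarilyEquivalent hw' (h1.trans h2.symm) fun ht => hs (h1.symm.trans ht),
    h1, h2⟩
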